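/- Let $\kappa>0$, $R>0$, $B_R=\{x\in\mathbb R^3:|x|<R\}$ and $\hat y=y/|y|$. Let $g(x,y)=\dfrac{e^{\mathrm i\kappa|x-y|}}{4\pi|x-y|}$ be the outgoing Green's function of the Helmholtz equation and $\boldsymbol G(x,y)=(\boldsymbol I+\kappa^{-2}\nabla_x\nabla_x)\,g(x,y)$ the dyadic Green's tensor of Maxwell's equations $\nabla\times(\nabla\times\boldsymbol E)-\kappa^2\boldsymbol E=\boldsymbol J$. For $\boldsymbol J\in(L^2(B_R))^3$ (complex valued) the radiated field is $$\boldsymbol E(x)=\int_{B_R}\boldsymbol G(x,y)\boldsymbol J(y)\,\mathrm dy,$$ and $\boldsymbol J$ is called nonradiating if $\boldsymbol E(x)=0$ for all $|x|>R$. Let $j_n$ be the spherical Bessel function of order $n$, let $$Y_n^m(\theta,\phi)=\sqrt{\tfrac{(2n+1)(n-|m|)!}{4\pi(n+|m|)!}}\;P_n^{|m|}(\cos\theta)\,e^{\mathrm im\phi},\qquad P_n^{k}(t)=(1-t^2)^{k/2}\frac{\mathrm d^kP_n}{\mathrm dt^k}(t),$$ with $P_n$ the Legendre polynomial of degree $n$,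 and put $\varphi_n^m(y)=j_n(\kappa|y|)\overline{Y_n^m(\hat y)}$. Define the vectors in $\mathbb C^3$ $$\alpha_n^m=\int_{B_R}\varphi_n^m\boldsymbol J\,\mathrm dy,\qquad \gamma_n^m=\frac1{\kappa^2}\int_{B_R}(\nabla\nabla\varphi_n^m)\boldsymbol J\,\mathrm dy,\qquad \beta_n^m=\int_{B_R}\big((\boldsymbol I+\kappa^{-2}\nabla\nabla)\varphi_n^m\big)\boldsymbol J\,\mathrm dy,$$ $$\zeta_n^m=-\frac1{\kappa^2}\int_{B_R}(\nabla\varphi_n^m)(\nabla\cdot\boldsymbol J)\,\mathrm dy,\qquad \eta_n^m=\frac1{\kappa^2}\int_{B_R}\varphi_n^m\,\nabla(\nabla\cdot\boldsymbol J)\,\mathrm dy,$$ the last two whenever $\nabla\cdot\boldsymbol J\in L^2(B_R)$, respectively $\nabla(\nabla\cdot\boldsymbol J)\in(L^2(B_R))^3$, in the sense of distributions in $B_R$. Let $H_0(\mathrm{div};B_R)$ be the space of all $\boldsymbol J\in(L^2(B_R))^3$ with $\nabla\cdot\boldsymbol J\in L^2(B_R)$ whose normal trace on $\partial B_R$ vanishes,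 and let $H(\mathrm{div};\mathrm{grad};B_R)$ be the space of all $\boldsymbol J\in(L^2(B_R))^3$ with $\nabla(\nabla\cdot\boldsymbol J)\in(L^2(B_R))^3$. Then, with $n$ ranging over $0,1,2,\dots$ and $m$ over $-n,\dots,n$: (i) If $\boldsymbol J\in(L^2(B_R))^3$, then $\beta_n^m=\alpha_n^m+\gamma_n^m$ for all $n,m$, and $\boldsymbol J$ is nonradiating if and only if $\alpha_n^m+\gamma_n^m=0$ for all $n,m$. (ii) If $\boldsymbol J\in H_0(\mathrm{div};B_R)$, then $\beta_n^m=\alpha_n^m+\zeta_n^m$ for all $n,m$, and $\boldsymbol J$ is nonradiating if and only if $\alpha_n^m+\zeta_n^m=0$ for all $n,m$. (iii) If $\boldsymbol J\in H(\mathrm{div};\mathrm{grad};B_R)$ has compact support contained in $B_R$, then $\boldsymbol J$ is nonradiating if and only if $\alpha_n^m+\eta_n^m=0$ for all $n,m$. -/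

import Mathlib

open MeasureTheory Metric
open scoped ContDiff

namespace Maxwell

/-- Points of three-dimensional Euclidean space. -/
abbrev R3 : Type := EuclideanSpace ℝ (Fin 3)

/-- Complex vectors: the values of currents and of electric fields. -/
abbrev C3 : Type := EuclideanSpace ℂ (Fin 3)

/-- The partial derivative `∂ φ / ∂ y_i` of a complex-valued function. -/
noncomputable def partialDeriv (i : Fin 3) (φ : R3 → ℂ) (y : R3) : ℂ :=
  fderiv ℝ φ y (EuclideanSpace.single i 1)

/-- The gradient `∇ φ`. -/
noncomputable def grad (φ : R3 → ℂ) (y : R3) : C3 :=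
  WithLp.toLp 2 fun i => partialDeriv i φ y

/-- The Hessian matrix `∇∇ φ`, with entries `∂² φ / ∂ y_l ∂ y_s`. -/
noncomputable def hess (φ : R3 → ℂ) (y : R3) : Matrix (Fin 3) (Fin 3) ℂ :=
  Matrix.of fun l s => partialDeriv l (partialDeriv s φ) y

/-- The matrix `(I + κ⁻² ∇∇) φ = φ I + κ⁻² ∇∇ φ`. -/
noncomputable def dyad (κ : ℝ) (φ : R3 → ℂ) (y : R3) : Matrix (Fin 3) (Fin 3) ℂ :=
  φ y • (1 : Matrix (Fin 3) (Fin 3) ℂ) + ((κ : ℂ) ^ 2)⁻¹ • hess φ y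

/-- A complex matrix applied to a complex vector. -/
noncomputable def apply (M : Matrix (Fin 3) (Fin 3) ℂ) (v : C3) : C3 :=
  WithLp.toLp 2 (M.mulVec v.ofLp)

/-- The outgoing Green's function of the Helmholtz equation,
`g(x, y) = exp(iκ|x - y|) / (4π|x - y|)`. -/
noncomputable def helmholtzGreen (κ : ℝ) (x y : R3) : ℂ :=
  Complex.exp (Complex.I * κ * (‖x - y‖ : ℝ)) / (4 * Real.pi * (‖x - y‖ : ℝ))

/-- The dyadic Green's tensor of Maxwell's equations, `G(x, y) = (I + κ⁻² ∇_x ∇_x) g(x, y)`. -/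
noncomputable def maxwellGreen (κ : ℝ) (x y : R3) : Matrix (Fin 3) (Fin 3) ℂ :=
  dyad κ (fun z => helmholtzGreen κ z y) x

/-- The electric field `E(x) = ∫_{B_R} G(x, y) J(y) dy` generated by `J` (used for `|x| > R`, where
`G(x, ·)` is smooth and bounded on `B_R`). -/
noncomputable def electricField (κ R : ℝ) (J : R3 → C3) (x : R3) : C3 :=
  ∫ y in ball (0 : R3) R, apply (maxwellGreen κ x y) (J y)

/-- The electric field generated by `J` vanishes identically outside the ball. -/
def Nonradiating (κ R : ℝ) (J : R3 → C3) : Prop :=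
  ∀ x : R3, R < ‖x‖ → electricField κ R J x = 0

/-- The spherical Bessel function of order `n`, by its everywhere convergent power series
`j_n(t) = ∑_k (-1)^k t^(n+2k) / (2^k k! (2n+2k+1)!!)`. -/
noncomputable def sphericalBessel (n : ℕ) (t : ℝ) : ℝ :=
  ∑' k : ℕ, (-1) ^ k * t ^ (n + 2 * k) /
    (2 ^ k * (Nat.factorial k : ℝ) * (Nat.doubleFactorial (2 * n + 2 * k + 1) : ℝ))

/-- The Legendre polynomial `P_n`, by Rodrigues' formula
`P_n = (1 / (2^n n!)) (d/dt)^n (t² - 1)^n`. -/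
noncomputable def legendre (n : ℕ) : Polynomial ℝ :=
  Polynomial.C ((2 ^ n * (Nat.factorial n : ℝ))⁻¹) *
    Polynomial.derivative^[n] ((Polynomial.X ^ 2 - 1) ^ n)

/-- The associated Legendre function `P_n^k(t) = (1 - t²)^(k/2) (d/dt)^k P_n(t)`, `|t| ≤ 1`. -/
noncomputable def assocLegendre (n k : ℕ) (t : ℝ) : ℝ :=
  Real.sqrt (1 - t ^ 2) ^ k * (Polynomial.derivative^[k] (legendre n)).eval t

/-- The spherical harmonic
`Y_n^m(θ, ϕ) = √((2n+1)(n-|m|)! / (4π(n+|m|)!)) P_n^{|m|}(cos θ) exp(imϕ)`, `|m| ≤ n`, at the unit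
vector `p = (sin θ cos ϕ, sin θ sin ϕ, cos θ)`, so that `cos θ = p₃` and `ϕ = arg(p₁ + i p₂)`. -/
noncomputable def sphericalHarmonic (n : ℕ) (m : ℤ) (p : R3) : ℂ :=
  (Real.sqrt ((2 * n + 1) * (Nat.factorial (n - m.natAbs) : ℝ) /
      (4 * Real.pi * (Nat.factorial (n + m.natAbs) : ℝ))) : ℂ) *
    (assocLegendre n m.natAbs (p 2) : ℂ) *
    Complex.exp (Complex.I * m * (Complex.arg ((p 0 : ℂ) + Complex.I * (p 1 : ℂ)) : ℝ))

/-- The function `y ↦ j_n(κ|y|) conj(Y_n^m(y / |y|))`. It is smooth on the whole space; at `y = 0`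
the formula gives its limit. -/
noncomputable def wave (κ : ℝ) (n : ℕ) (m : ℤ) (y : R3) : ℂ :=
  (sphericalBessel n (κ * ‖y‖) : ℂ) *
    (starRingEnd ℂ) (sphericalHarmonic n m (‖y‖⁻¹ • y))

/-- `β_n^m = ∫_{B_R} ((I + κ⁻² ∇∇)(j_n(κ|y|) conj(Y_n^m))) J(y) dy`. -/
noncomputable def betaCoeff (κ R : ℝ) (J : R3 → C3) (n : ℕ) (m : ℤ) : C3 :=
  ∫ y in ball (0 : R3) R, apply (dyad κ (wave κ n m) y) (J y)

/-- `α_n^m = ∫_{B_R} j_n(κ|y|) conj(Y_n^m) J(y) dy`. -/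
noncomputable def alphaCoeff (κ R : ℝ) (J : R3 → C3) (n : ℕ) (m : ℤ) : C3 :=
  ∫ y in ball (0 : R3) R, wave κ n m y • J y

/-- `γ_n^m = κ⁻² ∫_{B_R} (∇∇(j_n(κ|y|) conj(Y_n^m))) J(y) dy`. -/
noncomputable def gammaCoeff (κ R : ℝ) (J : R3 → C3) (n : ℕ) (m : ℤ) : C3 :=
  ((κ : ℂ) ^ 2)⁻¹ • ∫ y in ball (0 : R3) R, apply (hess (wave κ n m) y) (J y)

/-- `ζ_n^m = - κ⁻² ∫_{B_R} (∇ (j_n(κ|y|) conj(Y_n^m))) (∇·J)(y) dy`, as a function of `f = ∇·J`. -/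
noncomputable def zetaCoeff (κ R : ℝ) (f : R3 → ℂ) (n : ℕ) (m : ℤ) : C3 :=
  -(((κ : ℂ) ^ 2)⁻¹ • ∫ y in ball (0 : R3) R, f y • grad (wave κ n m) y)

/-- `η_n^m = κ⁻² ∫_{B_R} j_n(κ|y|) conj(Y_n^m) (∇(∇·J))(y) dy`, as a function of `F = ∇(∇·J)`. -/
noncomputable def etaCoeff (κ R : ℝ) (F : R3 → C3) (n : ℕ) (m : ℤ) : C3 :=
  ((κ : ℂ) ^ 2)⁻¹ • ∫ y in ball (0 : R3) R, wave κ n m y • F y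

/-- `u ∈ L²(B_R)`; only the values of `u` on the ball matter. -/
def InL2 {V : Type*} [NormedAddCommGroup V] (R : ℝ) (u : R3 → V) : Prop :=
  MemLp u 2 (volume.restrict (ball (0 : R3) R))

/-- `ψ ∈ C_c^∞(ℝ³)`. -/
def IsTest (ψ : R3 → ℂ) : Prop :=
  ContDiff ℝ ∞ ψ ∧ HasCompactSupport ψ

/-- `f ∈ L²(B_R)` is the distributional divergence `∇·J` of `J` in `B_R`. -/
def IsL2Div (R : ℝ) (J : R3 → C3) (f : R3 → ℂ) : Prop :=
  InL2 R f ∧ ∀ ψ : R3 → ℂ, IsTest ψ → tsupport ψ ⊆ ball 0 R →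
    ∫ y in ball (0 : R3) R, ∑ i, J y i * partialDeriv i ψ y =
      -∫ y in ball (0 : R3) R, f y * ψ y

/-- `F ∈ (L²(B_R))³` is the distribution `∇(∇·J)` in `B_R`. -/
def IsL2GradDiv (R : ℝ) (J F : R3 → C3) : Prop :=
  InL2 R F ∧ ∀ ψ : R3 → ℂ, IsTest ψ → tsupport ψ ⊆ ball 0 R → ∀ i : Fin 3,
    ∫ y in ball (0 : R3) R, ∑ j, J y j * partialDeriv j (partialDeriv i ψ) y =
      ∫ y in ball (0 : R3) R, F y i * ψ y

/-- The space `H(div; B_R)`. -/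
def Hdiv (R : ℝ) : Set (R3 → C3) :=
  {J | InL2 R J ∧ ∃ f, IsL2Div R J f}

/-- The normal trace `J·n` on `∂B_R` of a field `J` with divergence `f`, as a functional of `ψ`:
by Green's formula `∫_{∂B_R} (J·n) ψ ds = ∫_{B_R} (J·∇ψ + (∇·J) ψ) dy`. -/
noncomputable def normalTrace (R : ℝ) (J : R3 → C3) (f : R3 → ℂ) (ψ : R3 → ℂ) : ℂ :=
  ∫ y in ball (0 : R3) R, ((∑ i, J y i * partialDeriv i ψ y) + f y * ψ y)

/-- The space `H₀(div; B_R)` of the fields in `H(div; B_R)` whose normal trace vanishes. The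
functions `ψ` need not vanish near `∂B_R`; their restrictions are dense in `H¹(B_R)`. -/
def H0div (R : ℝ) : Set (R3 → C3) :=
  {J | J ∈ Hdiv R ∧ ∀ f, IsL2Div R J f → ∀ ψ, IsTest ψ → normalTrace R J f ψ = 0}

/-- The space `H(div; grad; B_R)`. -/
def HdivGrad (R : ℝ) : Set (R3 → C3) :=
  {J | InL2 R J ∧ ∃ F, IsL2GradDiv R J F}

/-- `J` has a compact (essential) support inside the open ball `B_R`. -/
def CompactlySupportedInBall (R : ℝ) (J : R3 → C3) : Prop :=
  ∃ K : Set R3, IsCompact K ∧ K ⊆ ball 0 R ∧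
    ∀ᵐ y ∂(volume.restrict (ball (0 : R3) R)), y ∉ K → J y = 0

end Maxwell

/-!
Write `D φ = (I + κ⁻² ∇∇) φ` and call `∫_{B_R} (D φ) J` the moment of `J` against `φ`
(`Maxwell.moment`), so that `β_n^m` is the moment against the wave
`j_n(κ|y|) conj(Y_n^m(y/|y|))`. The heart of the matter is that `J` is nonradiating if and only if
all its moments against the waves vanish (`Maxwell.nonradiating_iff_betaCoeff`). The proof replaces
the addition theorem for the Green's function and Rellich's lemma by complex analysis in one
variable, with the moments `H(a)` of `J` against the translates `j_0(κ|y - a|)` of the radial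
standing wave (`Maxwell.shiftMoment`) as the link.

*The field vanishes outside the ball if and only if `H(a) = 0` for `|a| > R`*
(`Maxwell.nonradiating_iff_shiftMoment`). Since `j_0(κr) = sin(κr)/(κr)`, for `|a| > R` the moment
`H(a)` is a multiple of `E_κ(a) - E_{-κ}(a)`, the difference of the outgoing and the incoming field.
In a direction `θ`, `E_κ(tθ) = exp(iκt)/t · Φ_{κ,θ}(1/t)`, where the amplitude `Φ_{κ,θ}` is
holomorphic in the disc of radius `1/R` (`Maxwell.farAmplitude`), because
`|tθ - y|/t = √(1 - 2sθ·y + s²|y|²)` with `s = 1/t`; moreover `Φ_{-κ,θ}(s) = Φ_{κ,-θ}(-s)`. If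
`E_κ = 0` outside the ball, then all amplitudes vanish identically, hence so does `E_{-κ}`, and
`H = 0`. If `H = 0`, then `exp(2iκ/s) Φ_{κ,θ}(s) = Φ_{-κ,θ}(s)`, which is impossible unless both
sides vanish, since the left factor has an essential singularity at `s = 0`
(`Maxwell.eqOn_zero_of_exp_mul_eq`).

*`H(a) = 0` for `|a| > R` if and only if the moments against the waves vanish.* In Cartesian
coordinates the waves are `J_n(κ²|y|²) (y₁ ∓ i y₂)^m Z(y)` with entire functions `J_n` and polynomials
`Z` given by Bonnet's recurrence (`Maxwell.cwave`, `Maxwell.exists_wave_eq`). The recurrences for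
`J_n` and `Z` show that the span of the waves is invariant under partial derivatives
(`Maxwell.partialDeriv_mem_waveSpan`), and that all waves arise from `j_0(κ|y|)` by differentiation
(`Maxwell.cwave_mem`). On each line `H` is the restriction of an entire function. So `H` vanishes
outside the ball if and only if it vanishes everywhere; in that case its derivatives at `0` vanish,
and these give the moments against the waves. Conversely, if the moments against the waves vanish,
then so do all derivatives of `H` at `0`, and `H = 0` by Taylor's formula.

The variants with `ζ_n^m` and `η_n^m` follow by integration by parts: the test function is a
derivative of the wave, respectively the wave itself, times a cutoff function, and in the second case
`∇(∇·J)` vanishes almost everywhere off the support of `J`.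
-/

namespace Maxwell

/-! ### Calculus of partial derivatives -/

lemma ContDiff.partialDeriv {φ : R3 → ℂ} (h : ContDiff ℝ ∞ φ) (i : Fin 3) :
    ContDiff ℝ ∞ (partialDeriv i φ) := by
  unfold Maxwell.partialDeriv
  exact (h.fderiv_right (m := ∞) (by simp)).clm_apply contDiff_const

lemma ContDiff.diffAt {φ : R3 → ℂ} (h : ContDiff ℝ ∞ φ) (y : R3) : DifferentiableAt ℝ φ y :=
  h.differentiable (by simp) y

lemma partialDeriv_congr {φ ψ : R3 → ℂ} {y : R3} (h : φ =ᶠ[nhds y] ψ) (i : Fin 3) :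
    partialDeriv i φ y = partialDeriv i ψ y := by
  unfold partialDeriv; rw [h.fderiv_eq]

lemma partialDeriv_add {φ ψ : R3 → ℂ} {y : R3} (i : Fin 3) (hφ : DifferentiableAt ℝ φ y)
    (hψ : DifferentiableAt ℝ ψ y) :
    partialDeriv i (fun y => φ y + ψ y) y = partialDeriv i φ y + partialDeriv i ψ y := by
  unfold partialDeriv; rw [fderiv_fun_add hφ hψ]; rfl

lemma partialDeriv_mul {φ ψ : R3 → ℂ} {y : R3} (i : Fin 3) (hφ : DifferentiableAt ℝ φ y)
    (hψ : DifferentiableAt ℝ ψ y) :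
    partialDeriv i (fun y => φ y * ψ y) y
      = partialDeriv i φ y * ψ y + φ y * partialDeriv i ψ y := by
  unfold partialDeriv; rw [fderiv_fun_mul hφ hψ]; simp; ring

lemma partialDeriv_const (i : Fin 3) (c : ℂ) (y : R3) : partialDeriv i (fun _ => c) y = 0 := by
  simp [partialDeriv]

lemma partialDeriv_const_mul {φ : R3 → ℂ} (i : Fin 3) (c : ℂ) (y : R3) :
    partialDeriv i (fun y => c * φ y) y = c * partialDeriv i φ y := by
  unfold partialDeriv
  rw [show (fun y => c * φ y) = c • φ from rfl, fderiv_const_smul_field]; rfl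

lemma partialDeriv_pow {φ : R3 → ℂ} {y : R3} (i : Fin 3) (hφ : DifferentiableAt ℝ φ y) (n : ℕ) :
    partialDeriv i (fun y => φ y ^ n) y = n * φ y ^ (n - 1) * partialDeriv i φ y := by
  unfold partialDeriv
  rw [fderiv_fun_pow n hφ]; simp

lemma partialDeriv_comp_sub {φ : R3 → ℂ} (i : Fin 3) (a y : R3) :
    partialDeriv i (fun y => φ (y - a)) y = partialDeriv i φ (y - a) := by
  unfold partialDeriv; rw [fderiv_comp_sub]

lemma partialDeriv_comm {φ : R3 → ℂ} (h : ContDiff ℝ ∞ φ) (i j : Fin 3) :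
    partialDeriv i (partialDeriv j φ) = partialDeriv j (partialDeriv i φ) := by
  funext y
  have hd : DifferentiableAt ℝ (fderiv ℝ φ) y :=
    (h.fderiv_right (m := ∞) (by simp)).differentiable (by simp) y
  have key : ∀ i j : Fin 3, Maxwell.partialDeriv i (Maxwell.partialDeriv j φ) y
      = fderiv ℝ (fderiv ℝ φ) y (EuclideanSpace.single i 1) (EuclideanSpace.single j 1) := by
    intro i j
    unfold Maxwell.partialDeriv
    rw [fderiv_clm_apply hd (differentiableAt_const _)]
    simp
  rw [key, key]
  exact (h.contDiffAt.isSymmSndFDerivAt (by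
    rw [minSmoothness_of_isRCLikeNormedField]
    exact WithTop.coe_le_coe.2 (le_top : (2 : ℕ∞) ≤ ⊤))) _ _

lemma differentiableAt_coord (j : Fin 3) (y : R3) :
    DifferentiableAt ℝ (fun y : R3 => ((y j : ℝ) : ℂ)) y := by
  fun_prop

lemma contDiff_coord (j : Fin 3) : ContDiff ℝ ∞ (fun y : R3 => ((y j : ℝ) : ℂ)) := by
  exact Complex.ofRealCLM.contDiff.comp (EuclideanSpace.proj (𝕜 := ℝ) j).contDiff

lemma partialDeriv_coord (i j : Fin 3) (y : R3) :
    partialDeriv i (fun y : R3 => ((y j : ℝ) : ℂ)) y = if j = i then 1 else 0 := by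
  have : HasFDerivAt (fun y : R3 => ((y j : ℝ) : ℂ))
      (Complex.ofRealCLM.comp (EuclideanSpace.proj (𝕜 := ℝ) j)) y :=
    (Complex.ofRealCLM.comp (EuclideanSpace.proj (𝕜 := ℝ) j)).hasFDerivAt
  unfold partialDeriv
  rw [this.fderiv]
  by_cases h : j = i <;> simp [h]

lemma hasFDerivAt_radial {f : ℝ → ℂ} {f' : ℂ} {y : R3} (hf : HasDerivAt f f' (‖y‖ ^ 2)) :
    HasFDerivAt (fun y : R3 => f (‖y‖ ^ 2))
      ((ContinuousLinearMap.toSpanSingleton ℝ f').comp (2 • (innerSL ℝ y))) y :=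
  hf.hasFDerivAt.comp y (hasStrictFDerivAt_norm_sq y).hasFDerivAt

lemma partialDeriv_radial {f : ℝ → ℂ} {f' : ℂ} {y : R3} (i : Fin 3)
    (hf : HasDerivAt f f' (‖y‖ ^ 2)) :
    partialDeriv i (fun y : R3 => f (‖y‖ ^ 2)) y = 2 * y i * f' := by
  unfold partialDeriv
  rw [(hasFDerivAt_radial hf).fderiv]
  simp [EuclideanSpace.inner_single_right, mul_assoc]

/-- The Hessian of a radial function `f(|y|²)` is `4 f'' y yᵀ + 2 f' I`. -/
lemma hess_radial {f f' : ℝ → ℂ} {f'' : ℂ} {y : R3}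
    (hf : ∀ᶠ q in nhds (‖y‖ ^ 2), HasDerivAt f (f' q) q) (hf' : HasDerivAt f' f'' (‖y‖ ^ 2))
    (l s : Fin 3) :
    hess (fun y : R3 => f (‖y‖ ^ 2)) y l s
      = 4 * f'' * y l * y s + (if l = s then 2 * f' (‖y‖ ^ 2) else 0) := by
  have h1 : partialDeriv s (fun y : R3 => f (‖y‖ ^ 2)) =ᶠ[nhds y]
      fun y => (2 * y s : ℂ) * f' (‖y‖ ^ 2) := by
    have : Filter.Tendsto (fun y : R3 => ‖y‖ ^ 2) (nhds y) (nhds (‖y‖ ^ 2)) :=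
      (continuous_norm.pow 2).tendsto y
    filter_upwards [this.eventually hf] with x hx
    exact partialDeriv_radial s hx
  simp only [hess, Matrix.of_apply]
  rw [partialDeriv_congr h1, partialDeriv_mul _ (by fun_prop)
    (hasFDerivAt_radial hf').differentiableAt, partialDeriv_radial l hf',
    partialDeriv_const_mul, partialDeriv_coord]
  by_cases h : l = s
  · subst h; simp; ring
  · simp [h, Ne.symm h]; ring

lemma dyad_apply (κ : ℝ) (φ : R3 → ℂ) (y : R3) (l s : Fin 3) :
    dyad κ φ y l s = (if l = s then φ y else 0)
      + ((κ : ℂ) ^ 2)⁻¹ * partialDeriv l (partialDeriv s φ) y := by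
  by_cases h : l = s
  · subst h; simp [dyad, hess]
  · simp [dyad, hess, h]

lemma dyad_congr {φ ψ : R3 → ℂ} {y : R3} (κ : ℝ) (h : φ =ᶠ[nhds y] ψ) :
    dyad κ φ y = dyad κ ψ y := by
  ext l s
  have : partialDeriv s φ =ᶠ[nhds y] partialDeriv s ψ := by
    filter_upwards [h.eventually_nhds] with x hx using partialDeriv_congr hx s
  rw [dyad_apply, dyad_apply, h.eq_of_nhds, partialDeriv_congr this]

lemma dyad_comp_sub (κ : ℝ) (φ : R3 → ℂ) (a y : R3) :
    dyad κ (fun y => φ (y - a)) y = dyad κ φ (y - a) := by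
  ext l s
  rw [dyad_apply, dyad_apply,
    show partialDeriv s (fun y => φ (y - a)) = fun y => partialDeriv s φ (y - a) from
      funext fun y => partialDeriv_comp_sub s a y, partialDeriv_comp_sub]

lemma dyad_add {φ ψ : R3 → ℂ} (κ : ℝ) (hφ : ContDiff ℝ ∞ φ) (hψ : ContDiff ℝ ∞ ψ) (y : R3) :
    dyad κ (fun y => φ y + ψ y) y = dyad κ φ y + dyad κ ψ y := by
  ext l s
  have h (s : Fin 3) : partialDeriv s (fun y => φ y + ψ y)
      = fun y => partialDeriv s φ y + partialDeriv s ψ y :=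
    funext fun y => partialDeriv_add s (ContDiff.diffAt hφ y) (ContDiff.diffAt hψ y)
  rw [Matrix.add_apply, dyad_apply, dyad_apply, dyad_apply, h,
    partialDeriv_add l (ContDiff.diffAt (ContDiff.partialDeriv hφ s) y)
      (ContDiff.diffAt (ContDiff.partialDeriv hψ s) y)]
  split_ifs <;> ring

lemma dyad_const_mul {φ : R3 → ℂ} (κ : ℝ) (c : ℂ) (y : R3) :
    dyad κ (fun y => c * φ y) y = c • dyad κ φ y := by
  ext l s
  have h (s : Fin 3) : partialDeriv s (fun y => c * φ y) = fun y => c * partialDeriv s φ y :=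
    funext fun y => partialDeriv_const_mul s c y
  rw [Matrix.smul_apply, dyad_apply, dyad_apply, h, partialDeriv_const_mul, smul_eq_mul]
  split_ifs <;> ring

lemma contDiff_dyad {φ : R3 → ℂ} (κ : ℝ) (hφ : ContDiff ℝ ∞ φ) (l s : Fin 3) :
    ContDiff ℝ ∞ (fun y => dyad κ φ y l s) := by
  simp_rw [dyad_apply]
  have h2 := ContDiff.partialDeriv (ContDiff.partialDeriv hφ s) l
  by_cases h : l = s
  · simp only [h, if_true]
    rw [h] at h2
    exact hφ.add (contDiff_const.mul h2)
  · simp only [h, if_false, zero_add]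
    exact contDiff_const.mul h2

/-- Partial derivatives commute with the operator `I + κ⁻² ∇∇`. -/
lemma partialDeriv_dyad {φ : R3 → ℂ} (κ : ℝ) (hφ : ContDiff ℝ ∞ φ) (i l s : Fin 3) (y : R3) :
    partialDeriv i (fun y => dyad κ φ y l s) y = dyad κ (partialDeriv i φ) y l s := by
  simp_rw [dyad_apply]
  have h2 := ContDiff.partialDeriv (ContDiff.partialDeriv hφ s) l
  have hc : partialDeriv i (partialDeriv l (partialDeriv s φ))
      = partialDeriv l (partialDeriv s (partialDeriv i φ)) := by
    rw [partialDeriv_comm (ContDiff.partialDeriv hφ s) i l, partialDeriv_comm hφ i s]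
  rw [← hc]
  by_cases h : l = s
  · simp only [h, if_true]
    rw [h] at h2
    rw [partialDeriv_add _ (ContDiff.diffAt hφ y)
      ((ContDiff.diffAt h2 y).const_mul _), partialDeriv_const_mul]
  · simp only [h, if_false, zero_add]
    rw [partialDeriv_const_mul]

/-! ### Entire Bessel functions -/

/-- The coefficient of `q^k` in the entire function `besselEntire n`. -/
noncomputable def besselCoeff (n k : ℕ) : ℂ :=
  (-1) ^ k / (2 ^ k * (Nat.factorial k : ℂ) * (Nat.doubleFactorial (2 * n + 2 * k + 1) : ℂ))

/-- The entire function `J_n(q) = ∑_k (-1)^k q^k / (2^k k! (2n+2k+1)!!)`, for which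
`j_n(t) = t^n J_n(t²)`. -/
noncomputable def besselEntire (n : ℕ) (q : ℂ) : ℂ := ∑' k : ℕ, besselCoeff n k * q ^ k

lemma norm_besselCoeff_le (n k : ℕ) : ‖besselCoeff n k‖ ≤ 1 / (Nat.factorial k : ℝ) := by
  have h1 : (1 : ℝ) ≤ 2 ^ k := one_le_pow₀ (by norm_num)
  have h2 : (1 : ℝ) ≤ (Nat.doubleFactorial (2 * n + 2 * k + 1) : ℝ) := by
    exact_mod_cast Nat.doubleFactorial_pos _
  have h3 : (0 : ℝ) < Nat.factorial k := by exact_mod_cast Nat.factorial_pos k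
  simp only [besselCoeff, norm_div, norm_pow, norm_neg, norm_one, one_pow, norm_mul,
    Complex.norm_natCast, Complex.norm_ofNat]
  apply one_div_le_one_div_of_le h3
  calc (Nat.factorial k : ℝ) = 1 * Nat.factorial k * 1 := by ring
    _ ≤ _ := by gcongr

lemma summable_besselEntire (n : ℕ) (q : ℂ) : Summable fun k => besselCoeff n k * q ^ k := by
  refine Summable.of_norm_bounded (g := fun k => ‖q‖ ^ k / (Nat.factorial k : ℝ))
    (Real.summable_pow_div_factorial ‖q‖) fun k => ?_
  rw [norm_mul, norm_pow]
  calc _ ≤ 1 / (Nat.factorial k : ℝ) * ‖q‖ ^ k := by gcongr; exact norm_besselCoeff_le n k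
    _ = _ := by ring

lemma besselCoeff_succ (n k : ℕ) :
    besselCoeff n (k + 1) * (k + 1) = -(1 / 2) * besselCoeff (n + 1) k := by
  have h3 : (Nat.factorial k : ℂ) ≠ 0 := by exact_mod_cast (Nat.factorial_pos k).ne'
  have h2 : (Nat.doubleFactorial (2 * (n + 1) + 2 * k + 1) : ℂ) ≠ 0 := by
    exact_mod_cast (Nat.doubleFactorial_pos _).ne'
  have h4 : (k + 1 : ℂ) ≠ 0 := by exact_mod_cast Nat.succ_ne_zero k
  rw [besselCoeff, besselCoeff, show 2 * n + 2 * (k + 1) + 1 = 2 * (n + 1) + 2 * k + 1 by ring,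
    Nat.factorial_succ]
  push_cast
  field_simp
  ring

lemma hasDerivAt_besselEntire (n : ℕ) (q : ℂ) :
    HasDerivAt (besselEntire n) (-(1 / 2) * besselEntire (n + 1) q) q := by
  set r : ℝ := ‖q‖ + 1
  have hr : 0 ≤ r := by positivity
  have hsum : Summable fun k : ℕ => (k : ℝ) * r ^ (k - 1) / (Nat.factorial k : ℝ) := by
    rw [← summable_nat_add_iff 1]
    refine (Real.summable_pow_div_factorial r).congr fun k => ?_
    have h3 : (Nat.factorial k : ℝ) ≠ 0 := by exact_mod_cast (Nat.factorial_pos k).ne'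
    rw [Nat.factorial_succ]; push_cast
    have h4 : (k + 1 : ℝ) ≠ 0 := by positivity
    field_simp
  have hd := hasDerivAt_tsum_of_isPreconnected (𝕜 := ℂ) (t := ball 0 r)
    (g := fun k q => besselCoeff n k * q ^ k)
    (g' := fun k q => besselCoeff n k * (k * q ^ (k - 1))) (y₀ := q) (y := q) hsum isOpen_ball
    (convex_ball _ _).isPreconnected
    (fun k y _ => (hasDerivAt_pow k y).const_mul _) (fun k y hy => by
      rw [norm_mul, norm_mul, norm_pow, Complex.norm_natCast]
      have hy' : ‖y‖ ≤ r := by simpa using (mem_ball.1 hy).le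
      calc _ ≤ 1 / (Nat.factorial k : ℝ) * (k * r ^ (k - 1)) := by
            gcongr; exact norm_besselCoeff_le n k
        _ = _ := by ring)
    (by simp [r]) (summable_besselEntire n q) (by simp [r])
  suffices h : -(1 / 2) * besselEntire (n + 1) q
      = ∑' k : ℕ, besselCoeff n k * (k * q ^ (k - 1)) by rw [h]; exact hd
  rw [show besselEntire (n + 1) q = ∑' k : ℕ, besselCoeff (n + 1) k * q ^ k from rfl,
    ← tsum_mul_left]
  have hs : Summable fun k : ℕ => besselCoeff n k * (k * q ^ (k - 1)) := by
    rw [← summable_nat_add_iff 1]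
    refine ((summable_besselEntire (n + 1) q).mul_left (-(1 / 2))).congr fun k => ?_
    rw [← mul_assoc, ← besselCoeff_succ]; push_cast; ring
  rw [hs.tsum_eq_zero_add]
  simp only [Nat.cast_zero, zero_mul, mul_zero, zero_add]
  refine tsum_congr fun k => ?_
  rw [← mul_assoc, ← besselCoeff_succ]; push_cast; ring

lemma differentiable_besselEntire (n : ℕ) : Differentiable ℂ (besselEntire n) := fun q =>
  (hasDerivAt_besselEntire n q).differentiableAt

/-- The three-term recurrence `j_{n-1}(t) + j_{n+1}(t) = (2n+1) j_n(t) / t`. -/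
lemma besselEntire_recurrence (n : ℕ) (q : ℂ) :
    besselEntire n q + q * besselEntire (n + 2) q = (2 * n + 3) * besselEntire (n + 1) q := by
  have h0 := summable_besselEntire n q
  have h1 := summable_besselEntire (n + 1) q
  have h2 := summable_besselEntire (n + 2) q
  have hd (k : ℕ) : (Nat.doubleFactorial (2 * (n + 1) + 2 * k + 1) : ℂ)
      = (2 * n + 2 * k + 3) * Nat.doubleFactorial (2 * n + 2 * k + 1) := by
    rw [show 2 * (n + 1) + 2 * k + 1 = (2 * n + 2 * k + 1) + 2 by ring, Nat.doubleFactorial_add_two]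
    push_cast; ring
  have hpos (j : ℕ) : (Nat.doubleFactorial j : ℂ) ≠ 0 := by
    exact_mod_cast (Nat.doubleFactorial_pos _).ne'
  have hf (k : ℕ) : (Nat.factorial k : ℂ) ≠ 0 := by exact_mod_cast (Nat.factorial_pos k).ne'
  have hc0 : besselCoeff n 0 = (2 * n + 3) * besselCoeff (n + 1) 0 := by
    have := hd 0
    have h5 := hpos (2 * n + 2 * 0 + 1)
    have h6 : (2 * n + 3 : ℂ) ≠ 0 := by
      exact_mod_cast (show 2 * n + 3 ≠ 0 by omega)
    simp only [besselCoeff]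
    rw [this]
    simp only [Nat.cast_zero, mul_zero, add_zero] at h5 ⊢
    field_simp
  have hc (k : ℕ) : besselCoeff n (k + 1) + besselCoeff (n + 2) k
      = (2 * n + 3) * besselCoeff (n + 1) (k + 1) := by
    have e1 := hd k
    have e2 : (Nat.doubleFactorial (2 * (n + 1) + 2 * (k + 1) + 1) : ℂ)
        = (2 * n + 2 * k + 5) * Nat.doubleFactorial (2 * (n + 1) + 2 * k + 1) := by
      rw [hd (k + 1), show 2 * n + 2 * (k + 1) + 1 = 2 * (n + 1) + 2 * k + 1 by ring]
      push_cast; ring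
    have h5 : (2 * n + 2 * k + 5 : ℂ) ≠ 0 := by
      exact_mod_cast (show 2 * n + 2 * k + 5 ≠ 0 by omega)
    have h7 : (k + 1 : ℂ) ≠ 0 := by exact_mod_cast Nat.succ_ne_zero k
    have h8 := hpos (2 * (n + 1) + 2 * k + 1)
    have h9 := hf k
    simp only [besselCoeff]
    rw [show 2 * n + 2 * (k + 1) + 1 = 2 * (n + 1) + 2 * k + 1 by ring,
      show 2 * (n + 2) + 2 * k + 1 = 2 * (n + 1) + 2 * (k + 1) + 1 by ring, e2,
      Nat.factorial_succ]
    push_cast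
    have h5' : (2 * (n + k) + 5 : ℂ) ≠ 0 := by rw [mul_add]; exact h5
    field_simp
    ring
  simp only [besselEntire]
  rw [h0.tsum_eq_zero_add, h1.tsum_eq_zero_add, ← tsum_mul_left, mul_add, ← tsum_mul_left,
    add_assoc, ← Summable.tsum_add ((summable_nat_add_iff 1).2 h0) (h2.mul_left q)]
  congr 1
  · rw [hc0]; ring
  · refine tsum_congr fun k => ?_
    linear_combination q ^ (k + 1) * hc k

lemma sphericalBessel_eq (n : ℕ) (t : ℝ) :
    (sphericalBessel n t : ℂ) = (t : ℂ) ^ n * besselEntire n ((t : ℂ) ^ 2) := by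
  rw [sphericalBessel, Complex.ofReal_tsum, besselEntire, ← tsum_mul_left]
  refine tsum_congr fun k => ?_
  simp only [besselCoeff]
  push_cast
  ring

/-- `j_0(t) = sin t / t`, in the form in which it holds at `t = 0` too. -/
lemma besselEntire_zero_mul (t : ℂ) : t * besselEntire 0 (t ^ 2) = Complex.sin t := by
  rw [besselEntire, ← tsum_mul_left, ← (Complex.hasSum_sin t).tsum_eq]
  refine tsum_congr fun k => ?_
  have h : (2 ^ k * (Nat.factorial k : ℂ) * (Nat.doubleFactorial (2 * 0 + 2 * k + 1) : ℂ))
      = Nat.factorial (2 * k + 1) := by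
    rw [show 2 * 0 + 2 * k + 1 = 2 * k + 1 by ring, Nat.factorial_eq_mul_doubleFactorial,
      Nat.doubleFactorial_two_mul]
    push_cast; ring
  rw [besselCoeff, h]
  ring

/-! ### Legendre polynomials -/

open Polynomial in
lemma iterate_derivative_X_mul (j : ℕ) (p : ℝ[X]) :
    derivative^[j + 1] (X * p) = X * derivative^[j + 1] p + (j + 1 : ℝ[X]) * derivative^[j] p := by
  induction j with
  | zero => simp; ring
  | succ j ih =>
    rw [Function.iterate_succ_apply', ih, Function.iterate_succ_apply' _ (j + 1),
      Function.iterate_succ_apply' _ j]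
    simp only [derivative_add, derivative_mul, derivative_X, derivative_natCast, derivative_one]
    push_cast; ring

open Polynomial in
/-- Two relations between `P_n`, `P_{n+1}` and their derivatives, from which the recurrences follow:
they come from differentiating `(X² - 1)^(n+1) = (X² - 1) (X² - 1)^n` in two ways. -/
lemma legendre_succ_and_derivative (n : ℕ) :
    ((n : ℝ[X]) + 1) * legendre (n + 1)
        = (X ^ 2 - 1) * derivative (legendre n) + ((n : ℝ[X]) + 1) * X * legendre n ∧
      derivative (legendre (n + 1))
        = ((n : ℝ[X]) + 1) * legendre n + X * derivative (legendre n) := by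
  have hfac : ((n + 1 : ℕ).factorial : ℝ) = (n + 1) * n.factorial := by
    rw [Nat.factorial_succ]; push_cast; ring
  have hn0 : (n.factorial : ℝ) ≠ 0 := by exact_mod_cast n.factorial_pos.ne'
  have hn1 : (n + 1 : ℝ) ≠ 0 := by positivity
  have hCcd : (C ((2 ^ n * (n.factorial : ℝ))⁻¹) : ℝ[X])
      = ((2 * (n + 1) : ℕ) : ℝ[X]) * C ((2 ^ (n + 1) * ((n + 1 : ℕ).factorial : ℝ))⁻¹) := by
    rw [← C_eq_natCast, ← C_mul]
    congr 1
    rw [hfac, pow_succ]; push_cast; field_simp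
  set d : ℝ := (2 ^ (n + 1) * ((n + 1 : ℕ).factorial : ℝ))⁻¹ with hd
  have hPn : legendre n = ((2 * (n + 1) : ℕ) : ℝ[X]) * C d * derivative^[n] ((X ^ 2 - 1) ^ n) := by
    rw [legendre, hCcd]
  have hPn1 : legendre (n + 1) = C d * derivative^[n + 1] ((X ^ 2 - 1) ^ (n + 1)) := by
    rw [legendre]
  set Q : ℝ[X] := (X ^ 2 - 1) ^ n with hQ
  have hQ1 : ((X : ℝ[X]) ^ 2 - 1) ^ (n + 1) = X * (X * Q) - Q := by rw [hQ, pow_succ]; ring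
  have hdQ : derivative (((X : ℝ[X]) ^ 2 - 1) ^ (n + 1)) = ((2 * (n + 1) : ℕ) : ℝ[X]) * (X * Q) := by
    rw [derivative_pow_succ, ← hQ]; simp; ring
  have hdP : derivative (legendre n)
      = ((2 * (n + 1) : ℕ) : ℝ[X]) * C d * derivative^[n + 1] Q := by
    rw [hPn, ← C_eq_natCast, ← C_mul, derivative_C_mul, Function.iterate_succ_apply']
  have hDD : derivative (derivative^[n + 1] (((X : ℝ[X]) ^ 2 - 1) ^ (n + 1)))
      = ((2 * (n + 1) : ℕ) : ℝ[X])
        * (X * derivative^[n + 1] Q + ((n : ℝ[X]) + 1) * derivative^[n] Q) := by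
    rw [← Function.iterate_succ_apply' derivative (n + 1), Function.iterate_succ_apply, hdQ,
      iterate_derivative_natCast_mul, iterate_derivative_X_mul]
  constructor
  · rcases n with _ | k
    · have hd' : d = 2⁻¹ := by simp [hd]
      rw [hPn1, hdP, hPn, hd', hQ]
      simp
      ring
    · have h1 : derivative^[k + 1 + 1] (((X : ℝ[X]) ^ 2 - 1) ^ (k + 1 + 1))
          = ((2 * (k + 1 + 1) : ℕ) : ℝ[X])
            * (X * derivative^[k + 1] Q + ((k : ℝ[X]) + 1) * derivative^[k] Q) := by
        rw [Function.iterate_succ_apply, hdQ, iterate_derivative_natCast_mul,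
          iterate_derivative_X_mul]
      have h2 : derivative^[k + 1 + 1] (((X : ℝ[X]) ^ 2 - 1) ^ (k + 1 + 1))
          = (X ^ 2 - 1) * derivative^[k + 1 + 1] Q
            + 2 * ((k : ℝ[X]) + 2) * X * derivative^[k + 1] Q
            + ((k : ℝ[X]) + 2) * ((k : ℝ[X]) + 1) * derivative^[k] Q := by
        rw [hQ1, iterate_derivative_sub]
        simp only [iterate_derivative_X_mul]
        push_cast; ring
      have h3 := h1.symm.trans h2
      rw [hPn1, hdP, hPn, h2]
      push_cast at h3 ⊢
      linear_combination ((k : ℝ[X]) + 2) * C d * h3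
  · rw [hPn1, derivative_C_mul, hDD, hdP, hPn]
    ring

/-- Bonnet's recurrence. -/
lemma legendre_bonnet (n : ℕ) :
    ((n : Polynomial ℝ) + 2) * legendre (n + 2)
      = (2 * (n : Polynomial ℝ) + 3) * Polynomial.X * legendre (n + 1)
        - ((n : Polynomial ℝ) + 1) * legendre n := by
  obtain ⟨h1, h2⟩ := legendre_succ_and_derivative n
  obtain ⟨h3, -⟩ := legendre_succ_and_derivative (n + 1)
  push_cast at h3
  rw [h2] at h3
  linear_combination h3 - Polynomial.X * h1

lemma legendre_derivative_sub (n : ℕ) :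
    Polynomial.derivative (legendre (n + 2)) - Polynomial.derivative (legendre n)
      = (2 * (n : Polynomial ℝ) + 3) * legendre (n + 1) := by
  obtain ⟨h1, h2⟩ := legendre_succ_and_derivative n
  obtain ⟨h3, h4⟩ := legendre_succ_and_derivative (n + 1)
  push_cast at h4
  rw [h4, h2]
  linear_combination -h1

open Polynomial in
/-- Bonnet's recurrence for the derivatives `P_n^{(m)}`. -/
lemma iterate_derivative_legendre_recurrence (m n : ℕ) :
    ((n : ℝ[X]) + 2 - (m : ℝ[X])) * derivative^[m] (legendre (n + 2))
      = (2 * (n : ℝ[X]) + 3) * X * derivative^[m] (legendre (n + 1))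
        - ((n : ℝ[X]) + 1 + (m : ℝ[X])) * derivative^[m] (legendre n) := by
  have hb := congrArg (fun p => derivative^[m] p) (legendre_bonnet n)
  have e1 : (n : ℝ[X]) + 2 = ((n + 2 : ℕ) : ℝ[X]) := by push_cast; ring
  have e2 : (2 * (n : ℝ[X]) + 3) * X * legendre (n + 1)
      = ((2 * n + 3 : ℕ) : ℝ[X]) * (X * legendre (n + 1)) := by push_cast; ring
  have e3 : (n : ℝ[X]) + 1 = ((n + 1 : ℕ) : ℝ[X]) := by push_cast; ring
  rw [iterate_derivative_sub, e1, e2, e3, iterate_derivative_natCast_mul,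
    iterate_derivative_natCast_mul, iterate_derivative_natCast_mul] at hb
  rcases m with _ | k
  · push_cast at hb ⊢
    simp only [Function.iterate_zero, id_eq] at hb ⊢
    linear_combination hb
  · have hd := congrArg (fun p => derivative^[k] p) (legendre_derivative_sub n)
    have e4 : (2 * (n : ℝ[X]) + 3) = ((2 * n + 3 : ℕ) : ℝ[X]) := by push_cast; ring
    rw [iterate_derivative_sub, e4, iterate_derivative_natCast_mul,
      ← Function.iterate_succ_apply, ← Function.iterate_succ_apply] at hd
    rw [iterate_derivative_X_mul] at hb
    push_cast at hb hd ⊢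
    linear_combination hb - ((k : ℝ[X]) + 1) * hd

open Polynomial in
/-- `P_m^{(m)}` is the nonzero constant `(2m - 1)!!`, and `P_{m+1}^{(m)} = (2m+1)!! X`. -/
lemma iterate_derivative_legendre_base (m : ℕ) :
    derivative^[m] (legendre m) = C ((2 * m - 1).doubleFactorial : ℝ) ∧
      derivative^[m] (legendre (m + 1)) = C ((2 * m + 1) * ((2 * m - 1).doubleFactorial : ℝ)) * X := by
  have h0 (m : ℕ) : derivative^[m] (legendre m) = C ((2 * m - 1).doubleFactorial : ℝ) := by
    induction m with
    | zero => simp [legendre]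
    | succ m ih =>
      have h := congrArg (fun p => derivative^[m] p) (legendre_succ_and_derivative m).2
      have e1 : (m : ℝ[X]) + 1 = ((m + 1 : ℕ) : ℝ[X]) := by push_cast; ring
      have hz : derivative^[m + 1] (legendre m) = 0 := by
        rw [Function.iterate_succ_apply', ih, derivative_C]
      have e2 : derivative^[m] (X * derivative (legendre m)) = (m : ℝ[X]) * derivative^[m] (legendre m) := by
        rcases m with _ | k
        · simp [legendre]
        · rw [iterate_derivative_X_mul, ← Function.iterate_succ_apply,
            ← Function.iterate_succ_apply, hz]
          push_cast; ring
      rw [← Function.iterate_succ_apply, iterate_map_add, e1, iterate_derivative_natCast_mul,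
        e2, ih] at h
      have e3 : (2 * (m + 1) - 1).doubleFactorial = (2 * m + 1) * (2 * m - 1).doubleFactorial := by
        rcases m with _ | k
        · simp
        · rw [show 2 * (k + 1 + 1) - 1 = (2 * k + 1) + 2 by omega, Nat.doubleFactorial_add_two]
          rfl
      rw [h, e3]
      push_cast
      simp [C_ofNat]
      ring
  refine ⟨h0 m, ?_⟩
  rcases m with _ | k
  · have h := (legendre_succ_and_derivative 0).1
    simp [legendre] at h
    simp [legendre]
    exact h
  · have h := iterate_derivative_legendre_recurrence (k + 1) k
    have hz : derivative^[k + 1] (legendre k) = 0 := by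
      rw [Function.iterate_succ_apply', h0 k, derivative_C]
    rw [hz, h0 (k + 1)] at h
    push_cast at h
    have e : ((k : ℝ[X]) + 2 - (k + 1)) = 1 := by ring
    rw [e, one_mul] at h
    rw [h]
    push_cast
    simp [C_ofNat]
    ring

/-! ### The waves in Cartesian coordinates -/

/-- The axially symmetric factor `solid m d` of the solid harmonic of degree `m + d` and order `m`:
`|y|^d P_{m+d}^{(m)}(y₃/|y|) = (2m-1)!! solid m d y`. It is a polynomial in `y₃` and `|y|²`, here
defined by the recurrence in the degree. -/
noncomputable def solid (m : ℕ) : ℕ → R3 → ℂ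
  | 0 => fun _ => 1
  | 1 => fun y => (2 * m + 1) * (y 2 : ℂ)
  | d + 2 => fun y => ((d : ℂ) + 2)⁻¹ * ((2 * (m + d) + 3) * ((y 2 : ℂ) * solid m (d + 1) y)
      - (2 * m + d + 1) * (((‖y‖ ^ 2 : ℝ) : ℂ) * solid m d y))

lemma solid_zero (m : ℕ) (y : R3) : solid m 0 y = 1 := by simp [solid]

lemma solid_one (m : ℕ) (y : R3) : solid m 1 y = (2 * m + 1) * (y 2 : ℂ) := by simp [solid]

lemma solid_add_two (m d : ℕ) (y : R3) :
    solid m (d + 2) y = ((d : ℂ) + 2)⁻¹ * ((2 * (m + d) + 3) * ((y 2 : ℂ) * solid m (d + 1) y)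
      - (2 * m + d + 1) * (((‖y‖ ^ 2 : ℝ) : ℂ) * solid m d y)) := by
  simp only [solid]

lemma solid_recurrence (m d : ℕ) (y : R3) :
    ((d : ℂ) + 2) * solid m (d + 2) y = (2 * (m + d) + 3) * ((y 2 : ℂ) * solid m (d + 1) y)
      - (2 * m + d + 1) * (((‖y‖ ^ 2 : ℝ) : ℂ) * solid m d y) := by
  have h : ((d : ℂ) + 2) ≠ 0 := by exact_mod_cast (show d + 2 ≠ 0 by omega)
  rw [solid_add_two, mul_inv_cancel_left₀ h]

lemma norm_mul_inv_coord (y : R3) (i : Fin 3) : ‖y‖ * (‖y‖⁻¹ * y i) = y i := by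
  rcases eq_or_ne y 0 with rfl | h
  · simp
  · rw [mul_inv_cancel_left₀ (norm_ne_zero_iff.2 h)]

lemma pow_mul_eval_legendre (m d : ℕ) (y : R3) :
    (((‖y‖ ^ d * (Polynomial.derivative^[m] (legendre (m + d))).eval (‖y‖⁻¹ * y 2) : ℝ)) : ℂ)
      = ((2 * m - 1).doubleFactorial : ℂ) * solid m d y := by
  obtain ⟨hb0, hb1⟩ := iterate_derivative_legendre_base m
  have hr := norm_mul_inv_coord y 2
  induction d using Nat.strong_induction_on with
  | _ d ih =>
    match d with
    | 0 => rw [add_zero, hb0]; simp [solid_zero]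
    | 1 =>
      rw [hb1, solid_one, Polynomial.eval_C_mul, Polynomial.eval_X]
      have hr' := congrArg (fun x : ℝ => (x : ℂ)) hr
      push_cast at hr' ⊢
      linear_combination (2 * m + 1) * ((2 * m - 1).doubleFactorial : ℂ) * hr'
    | d + 2 =>
      have h : ((d : ℂ) + 2) ≠ 0 := by exact_mod_cast (show d + 2 ≠ 0 by omega)
      apply mul_left_cancel₀ h
      have h0 := ih d (by omega)
      have h1 := ih (d + 1) (by omega)
      have hrec := congrArg (fun p => Polynomial.eval (‖y‖⁻¹ * y 2) p)
        (iterate_derivative_legendre_recurrence m (m + d))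
      simp only [Polynomial.eval_mul, Polynomial.eval_sub, Polynomial.eval_add,
        Polynomial.eval_natCast, Polynomial.eval_ofNat, Polynomial.eval_X, Polynomial.eval_one]
        at hrec
      rw [← add_assoc] at h1 ⊢
      set p0 := Polynomial.eval (‖y‖⁻¹ * y 2) (Polynomial.derivative^[m] (legendre (m + d)))
      set p1 := Polynomial.eval (‖y‖⁻¹ * y 2) (Polynomial.derivative^[m] (legendre (m + d + 1)))
      set p2 := Polynomial.eval (‖y‖⁻¹ * y 2) (Polynomial.derivative^[m] (legendre (m + d + 2)))
      have hrec' := congrArg (fun x : ℝ => (x : ℂ)) hrec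
      have hr' := congrArg (fun x : ℝ => (x : ℂ)) hr
      have hs := solid_recurrence m d y
      push_cast at h0 h1 hrec' hr' hs ⊢
      set r : ℂ := (‖y‖ : ℂ)
      linear_combination r ^ (d + 2) * hrec' - ((2 * m - 1).doubleFactorial : ℂ) * hs
        + (2 * (m + d) + 3) * (y 2 : ℂ) * h1 - (2 * m + d + 1) * r ^ 2 * h0
        + (2 * (m + d) + 3) * r ^ (d + 1) * p1 * hr'

/-- `|y| sin θ exp(iϕ) = y₁ + i y₂`; at `y = 0` and on the `y₃`-axis both sides vanish. -/
lemma norm_mul_sqrt_mul_exp (y : R3) :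
    (‖y‖ : ℂ) * (Real.sqrt (1 - (‖y‖⁻¹ * y 2) ^ 2) : ℂ)
      * Complex.exp (Complex.I * (Complex.arg (((‖y‖⁻¹ * y 0 : ℝ) : ℂ)
        + Complex.I * ((‖y‖⁻¹ * y 1 : ℝ) : ℂ)) : ℝ)) = y 0 + Complex.I * y 1 := by
  rcases eq_or_ne y 0 with rfl | h
  · simp
  · have hy : ‖y‖ ≠ 0 := norm_ne_zero_iff.2 h
    have hsq : ‖y‖ ^ 2 = y 0 ^ 2 + y 1 ^ 2 + y 2 ^ 2 := by
      rw [EuclideanSpace.real_norm_sq_eq, Fin.sum_univ_three]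
    have hn : Real.sqrt (1 - (‖y‖⁻¹ * y 2) ^ 2)
        = ‖(((‖y‖⁻¹ * y 0 : ℝ) : ℂ) + Complex.I * ((‖y‖⁻¹ * y 1 : ℝ) : ℂ))‖ := by
      rw [mul_comm Complex.I, Complex.norm_add_mul_I]
      congr 1
      field_simp
      linear_combination hsq
    rw [hn, mul_comm Complex.I (Complex.arg _ : ℂ), mul_assoc, Complex.norm_mul_exp_arg_mul_I]
    have h0 := congrArg (fun x : ℝ => (x : ℂ)) (norm_mul_inv_coord y 0)
    have h1 := congrArg (fun x : ℝ => (x : ℂ)) (norm_mul_inv_coord y 1)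
    push_cast at h0 h1 ⊢
    linear_combination h0 + Complex.I * h1

/-- The functions `J_{m+d}(κ²|y|²) (y₁ + ε y₂)^m solid m d y`. For `ε = ± i` these are, up to nonzero
constant factors, the waves of degree `m + d` and order `∓ m`. -/
noncomputable def cwave (κ : ℝ) (ε : ℂ) (m d : ℕ) (y : R3) : ℂ :=
  besselEntire (m + d) ((κ ^ 2 * ‖y‖ ^ 2 : ℝ) : ℂ) * (y 0 + ε * y 1) ^ m * solid m d y

/-- The wave of degree `m + d` and order `±m` in Cartesian coordinates. The complex conjugation in
`wave` is the reason for the sign of `∓ i`; there is no exceptional point `y = 0`, as both sides are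
given by formulas valid there. -/
lemma exists_wave_eq {κ : ℝ} (hκ : 0 < κ) (m d : ℕ) (k : ℤ) (hk : k = m ∨ k = -m) :
    ∃ c : ℂ, c ≠ 0 ∧ ∀ y, wave κ (m + d) k y
      = c * cwave κ (if k = m then -Complex.I else Complex.I) m d y := by
  have habs : k.natAbs = m := by omega
  set N : ℝ := Real.sqrt ((2 * (m + d : ℕ) + 1) * (Nat.factorial (m + d - m) : ℝ) /
      (4 * Real.pi * (Nat.factorial (m + d + m) : ℝ))) with hN
  have hN0 : N ≠ 0 := by
    have h1 : (0 : ℝ) < Nat.factorial (m + d - m) := by exact_mod_cast Nat.factorial_pos _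
    have h2 : (0 : ℝ) < Nat.factorial (m + d + m) := by exact_mod_cast Nat.factorial_pos _
    have := Real.pi_pos
    exact (Real.sqrt_pos.2 (by positivity)).ne'
  refine ⟨κ ^ (m + d) * N * ((2 * m - 1).doubleFactorial : ℂ), ?_, fun y => ?_⟩
  · refine mul_ne_zero (mul_ne_zero (pow_ne_zero _ ?_) ?_) ?_
    · exact_mod_cast hκ.ne'
    · exact_mod_cast hN0
    · exact_mod_cast (Nat.doubleFactorial_pos _).ne'
  have hleg := pow_mul_eval_legendre m d y
  have hexp := norm_mul_sqrt_mul_exp y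
  have hexp' : (‖y‖ : ℂ) * (Real.sqrt (1 - (‖y‖⁻¹ * y 2) ^ 2) : ℂ)
      * Complex.exp (-(Complex.I * (Complex.arg (((‖y‖⁻¹ * y 0 : ℝ) : ℂ)
        + Complex.I * ((‖y‖⁻¹ * y 1 : ℝ) : ℂ)) : ℝ))) = y 0 - Complex.I * y 1 := by
    have := congrArg (starRingEnd ℂ) hexp
    simp only [map_mul, map_add, ← Complex.exp_conj, Complex.conj_ofReal, Complex.conj_I] at this
    rw [neg_mul] at this
    rw [this]; ring
  rw [wave, sphericalBessel_eq, sphericalHarmonic, assocLegendre, habs, ← hN]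
  simp only [PiLp.smul_apply, smul_eq_mul, map_mul, ← Complex.exp_conj, Complex.conj_ofReal,
    Complex.conj_I, map_intCast]
  set s : ℂ := (Real.sqrt (1 - (‖y‖⁻¹ * y 2) ^ 2) : ℂ) with hs
  set φ : ℂ := ((Complex.arg (((‖y‖⁻¹ * y 0 : ℝ) : ℂ)
        + Complex.I * ((‖y‖⁻¹ * y 1 : ℝ) : ℂ)) : ℝ) : ℂ)
  set p := Polynomial.eval (‖y‖⁻¹ * y 2) (Polynomial.derivative^[m] (legendre (m + d)))
  have hw : (‖y‖ : ℂ) ^ m * s ^ m * Complex.exp (-Complex.I * k * φ)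
      = (y 0 + (if k = m then -Complex.I else Complex.I) * y 1) ^ m := by
    rcases hk with hk | hk
    · rw [if_pos hk, hk]
      rw [show -Complex.I * ((m : ℤ) : ℂ) * φ = m * (-(Complex.I * φ)) by push_cast; ring,
        Complex.exp_nat_mul, ← mul_pow, ← mul_pow, hexp']
      ring
    · by_cases hm : k = m
      · have : m = 0 := by omega
        subst this
        have : k = 0 := by omega
        subst this
        simp
      rw [if_neg hm, hk]
      rw [show -Complex.I * ((-(m : ℤ) : ℤ) : ℂ) * φ = m * (Complex.I * φ) by push_cast; ring,
        Complex.exp_nat_mul, ← mul_pow, ← mul_pow, hexp]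
  rw [cwave, ← hw]
  push_cast at hleg ⊢
  rw [mul_pow, mul_pow (κ : ℂ) (‖y‖ : ℂ) 2, pow_add (‖y‖ : ℂ) m d]
  linear_combination (κ : ℂ) ^ (m + d) * N * (‖y‖ : ℂ) ^ m * s ^ m
    * Complex.exp (-Complex.I * k * φ) * besselEntire (m + d) (κ ^ 2 * ‖y‖ ^ 2) * hleg

/-! ### Derivatives of the waves -/

lemma contDiff_normSq : ContDiff ℝ ∞ (fun y : R3 => ((‖y‖ ^ 2 : ℝ) : ℂ)) :=
  Complex.ofRealCLM.contDiff.comp (contDiff_norm_sq ℝ)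

lemma contDiff_solid (m d : ℕ) : ContDiff ℝ ∞ (solid m d) := by
  induction d using Nat.strong_induction_on with
  | _ d ih =>
    match d with
    | 0 => rw [funext (solid_zero m)]; exact contDiff_const
    | 1 => rw [funext (solid_one m)]; exact contDiff_const.mul (contDiff_coord 2)
    | d + 2 =>
      rw [funext (solid_add_two m d)]
      exact contDiff_const.mul ((contDiff_const.mul ((contDiff_coord 2).mul (ih (d + 1)
        (by omega)))).sub (contDiff_const.mul (contDiff_normSq.mul (ih d (by omega)))))

lemma partialDeriv_normSq (i : Fin 3) (y : R3) :
    partialDeriv i (fun y : R3 => ((‖y‖ ^ 2 : ℝ) : ℂ)) y = 2 * y i := by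
  have := partialDeriv_radial (f := fun q : ℝ => (q : ℂ)) (f' := 1) (y := y) i
    (Complex.ofRealCLM.hasDerivAt (x := ‖y‖ ^ 2))
  rw [this, mul_one]

/-- `∂/∂y₃` lowers the degree of a solid harmonic. -/
lemma partialDeriv_solid (m d : ℕ) (y : R3) :
    partialDeriv 2 (solid m (d + 1)) y = (d + 1 + 2 * m) * solid m d y := by
  have hd (d : ℕ) (y : R3) := ContDiff.diffAt (contDiff_solid m d) y
  induction d using Nat.strong_induction_on with
  | _ d ih =>
    match d with
    | 0 =>
      rw [show solid m (0 + 1) = fun y : R3 => (2 * m + 1 : ℂ) * (y 2 : ℂ) from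
        funext fun y => solid_one m y, partialDeriv_const_mul, partialDeriv_coord, solid_zero]
      simp; ring
    | d + 1 =>
      have h2 : ((d : ℂ) + 2) ≠ 0 := by exact_mod_cast (show d + 2 ≠ 0 by omega)
      have ih1 := ih d (by omega)
      have hA : partialDeriv 2 (fun y : R3 => ((y 2 : ℝ) : ℂ) * solid m (d + 1) y) y
          = solid m (d + 1) y + y 2 * ((d + 1 + 2 * m) * solid m d y) := by
        rw [partialDeriv_mul _ (differentiableAt_coord 2 y) (hd _ y), ih1, partialDeriv_coord]
        simp
      have hB : (d + 1 + 2 * m : ℂ) *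
          partialDeriv 2 (fun y : R3 => ((‖y‖ ^ 2 : ℝ) : ℂ) * solid m d y) y
          = (d + 1 + 2 * m) * (2 * y 2 * solid m d y)
            + (d + 1 + 2 * m) * ((2 * (m + d) + 1) * (y 2 * solid m d y)
              - (d + 1) * solid m (d + 1) y) := by
        rw [partialDeriv_mul _ (ContDiff.diffAt contDiff_normSq y) (hd _ y), partialDeriv_normSq]
        match d with
        | 0 =>
          rw [show solid m 0 = fun _ => 1 from funext fun y => solid_zero m y,
            partialDeriv_const, solid_one]
          push_cast; ring
        | d + 1 =>
          rw [ih d (by omega)]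
          have := solid_recurrence m d y
          push_cast at this ⊢
          linear_combination (d + 2 + 2 * m : ℂ) * this
      rw [show solid m (d + 1 + 1) = fun y => ((d : ℂ) + 2)⁻¹ *
          ((2 * (m + d) + 3) * ((y 2 : ℂ) * solid m (d + 1) y)
            + (-(2 * m + d + 1)) * (((‖y‖ ^ 2 : ℝ) : ℂ) * solid m d y)) from
          funext fun y => by rw [solid_add_two]; ring,
        partialDeriv_const_mul, partialDeriv_add _
          (((differentiableAt_coord 2 y).fun_mul (hd _ y)).const_mul _)
          (((ContDiff.diffAt contDiff_normSq y).fun_mul (hd _ y)).const_mul _),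
        partialDeriv_const_mul, partialDeriv_const_mul, hA]
      apply mul_left_cancel₀ h2
      rw [mul_inv_cancel_left₀ h2]
      push_cast at hB ⊢
      linear_combination -hB

/-- The radial factor `J_n(κ²|y|²)` of the waves. -/
noncomputable def besselRadial (κ : ℝ) (n : ℕ) (y : R3) : ℂ :=
  besselEntire n ((κ ^ 2 * ‖y‖ ^ 2 : ℝ) : ℂ)

lemma hasDerivAt_besselEntire_ofReal (κ : ℝ) (n : ℕ) (q : ℝ) :
    HasDerivAt (fun q : ℝ => besselEntire n ((κ ^ 2 * q : ℝ) : ℂ))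
      (-(κ ^ 2 / 2) * besselEntire (n + 1) ((κ ^ 2 * q : ℝ) : ℂ)) q := by
  have h1 : HasDerivAt (fun q : ℝ => ((κ ^ 2 * q : ℝ) : ℂ)) ((κ ^ 2 : ℝ) : ℂ) q := by
    have := ((hasDerivAt_id q).const_mul (κ ^ 2)).ofReal_comp
    simpa using this
  have := (hasDerivAt_besselEntire n ((κ ^ 2 * q : ℝ) : ℂ)).comp q h1
  refine this.congr_deriv ?_
  push_cast; ring

lemma contDiff_besselRadial (κ : ℝ) (n : ℕ) : ContDiff ℝ ∞ (besselRadial κ n) := by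
  have h1 : ContDiff ℝ ∞ (besselEntire n) :=
    ((differentiable_besselEntire n).contDiff (n := ∞)).restrict_scalars ℝ
  have h2 : ContDiff ℝ ∞ (fun y : R3 => ((κ ^ 2 * ‖y‖ ^ 2 : ℝ) : ℂ)) :=
    Complex.ofRealCLM.contDiff.comp (contDiff_const.mul (contDiff_norm_sq ℝ))
  exact h1.comp h2

lemma partialDeriv_besselRadial (κ : ℝ) (n : ℕ) (i : Fin 3) (y : R3) :
    partialDeriv i (besselRadial κ n) y = -κ ^ 2 * y i * besselRadial κ (n + 1) y := by
  have := partialDeriv_radial (f := fun q : ℝ => besselEntire n ((κ ^ 2 * q : ℝ) : ℂ)) i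
    (hasDerivAt_besselEntire_ofReal κ n (‖y‖ ^ 2))
  rw [show besselRadial κ n = fun y : R3 => besselEntire n ((κ ^ 2 * ‖y‖ ^ 2 : ℝ) : ℂ) from rfl,
    this, besselRadial]
  ring

lemma besselRadial_recurrence (κ : ℝ) (n : ℕ) (y : R3) :
    besselRadial κ n y + κ ^ 2 * ((‖y‖ ^ 2 : ℝ) : ℂ) * besselRadial κ (n + 2) y
      = (2 * n + 3) * besselRadial κ (n + 1) y := by
  have := besselEntire_recurrence n ((κ ^ 2 * ‖y‖ ^ 2 : ℝ) : ℂ)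
  simp only [besselRadial]
  rw [← this]; push_cast; ring

lemma contDiff_linear (ε : ℂ) : ContDiff ℝ ∞ (fun y : R3 => (y 0 : ℂ) + ε * y 1) :=
  (contDiff_coord 0).add (contDiff_const.mul (contDiff_coord 1))

lemma partialDeriv_linear (i : Fin 3) (ε : ℂ) (y : R3) :
    partialDeriv i (fun y : R3 => (y 0 : ℂ) + ε * y 1) y
      = (if 0 = i then 1 else 0) + ε * (if 1 = i then 1 else 0) := by
  rw [partialDeriv_add _ (differentiableAt_coord 0 y) ((differentiableAt_coord 1 y).const_mul _),
    partialDeriv_const_mul, partialDeriv_coord, partialDeriv_coord]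

lemma cwave_eq (κ : ℝ) (ε : ℂ) (m d : ℕ) :
    cwave κ ε m d = fun y =>
      (besselRadial κ (m + d) y * ((y 0 : ℂ) + ε * y 1) ^ m) * solid m d y := rfl

lemma contDiff_cwave (κ : ℝ) (ε : ℂ) (m d : ℕ) : ContDiff ℝ ∞ (cwave κ ε m d) := by
  rw [cwave_eq]
  exact ((contDiff_besselRadial κ _).mul ((contDiff_linear ε).pow m)).mul (contDiff_solid m d)

lemma partialDeriv_cwave (κ : ℝ) (ε : ℂ) (m d : ℕ) (i : Fin 3) (y : R3) :
    partialDeriv i (cwave κ ε m d) y =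
      (-κ ^ 2 * y i * besselRadial κ (m + d + 1) y * ((y 0 : ℂ) + ε * y 1) ^ m
        + besselRadial κ (m + d) y * (m * ((y 0 : ℂ) + ε * y 1) ^ (m - 1)
          * ((if 0 = i then 1 else 0) + ε * (if 1 = i then 1 else 0)))) * solid m d y
      + besselRadial κ (m + d) y * ((y 0 : ℂ) + ε * y 1) ^ m * partialDeriv i (solid m d) y := by
  have h1 := ContDiff.diffAt (contDiff_besselRadial κ (m + d)) y
  have h2 := ContDiff.diffAt (contDiff_linear ε) y
  have h3 := ContDiff.diffAt (contDiff_solid m d) y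
  rw [cwave_eq, partialDeriv_mul _ (h1.fun_mul (h2.fun_pow m)) h3,
    partialDeriv_mul _ h1 (h2.fun_pow m),
    partialDeriv_besselRadial, partialDeriv_pow _ h2, partialDeriv_linear]

lemma partialDeriv_solid_zero (m : ℕ) (i : Fin 3) (y : R3) : partialDeriv i (solid m 0) y = 0 := by
  rw [show solid m 0 = fun _ => 1 from funext fun y => solid_zero m y, partialDeriv_const]

/-- `∂₁ + ε ∂₂` raises degree and order of a sectoral wave, since it annihilates `y₁ + ε y₂`. -/
lemma raise_cwave (κ : ℝ) {ε : ℂ} (hε : ε ^ 2 = -1) (m : ℕ) :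
    partialDeriv 0 (cwave κ ε m 0) + ε • partialDeriv 1 (cwave κ ε m 0)
      = (-(κ : ℂ) ^ 2) • cwave κ ε (m + 1) 0 := by
  funext y
  simp only [Pi.add_apply, Pi.smul_apply, smul_eq_mul]
  rw [partialDeriv_cwave, partialDeriv_cwave, cwave_eq, partialDeriv_solid_zero,
    partialDeriv_solid_zero]
  simp only [add_zero, solid_zero]
  simp
  linear_combination (besselRadial κ m y * (m * ((y 0 : ℂ) + ε * y 1) ^ (m - 1))) * hε

/-- `∂₁ - ε ∂₂` lowers the order of a sectoral wave. The right-hand side is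
`f + κ⁻² ∂₃² f` for the sectoral wave `f` of order `m`, as the Helmholtz equation
`(∂₁ - ε ∂₂)(∂₁ + ε ∂₂) f = -κ² f - ∂₃² f` requires. -/
lemma lower_cwave {κ : ℝ} {ε : ℂ} (hε : ε ^ 2 = -1) (m : ℕ) :
    partialDeriv 0 (cwave κ ε (m + 1) 0) + (-ε) • partialDeriv 1 (cwave κ ε (m + 1) 0)
      = cwave κ ε m 0 - ((2 * m + 1 : ℂ)⁻¹) • partialDeriv 2 (cwave κ ε m 1) := by
  funext y
  have h0 : (2 * m + 1 : ℂ) ≠ 0 := by exact_mod_cast (show 2 * m + 1 ≠ 0 by omega)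
  have hrec := besselRadial_recurrence κ m y
  have hsq : ‖y‖ ^ 2 = y 0 ^ 2 + y 1 ^ 2 + y 2 ^ 2 := by
    rw [EuclideanSpace.real_norm_sq_eq, Fin.sum_univ_three]
  have hsol := partialDeriv_solid m 0 y
  rw [zero_add] at hsol
  rw [hsq] at hrec
  simp only [Pi.add_apply, Pi.sub_apply, Pi.smul_apply, smul_eq_mul]
  rw [partialDeriv_cwave, partialDeriv_cwave, partialDeriv_cwave, cwave_eq,
    partialDeriv_solid_zero, partialDeriv_solid_zero, hsol]
  simp only [solid_zero, solid_one]
  simp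
  push_cast at hrec
  have ht := inv_mul_cancel₀ h0
  linear_combination (-((y 0 : ℂ) + ε * y 1) ^ m) * hrec
    - ((y 0 : ℂ) + ε * y 1) ^ m
      * (κ ^ 2 * besselRadial κ (m + 2) y * y 2 ^ 2 - besselRadial κ (m + 1) y) * ht
    + ((y 0 : ℂ) + ε * y 1) ^ m * (κ ^ 2 * y 1 ^ 2 * besselRadial κ (m + 2) y
      - (m + 1) * besselRadial κ (m + 1) y) * hε

lemma partialDeriv_two_cwave_zero (κ : ℝ) (ε : ℂ) (m : ℕ) :
    partialDeriv 2 (cwave κ ε m 0) = (-(κ : ℂ) ^ 2 / (2 * m + 1)) • cwave κ ε m 1 := by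
  funext y
  have h0 : (2 * m + 1 : ℂ) ≠ 0 := by exact_mod_cast (show 2 * m + 1 ≠ 0 by omega)
  simp only [Pi.smul_apply, smul_eq_mul]
  rw [partialDeriv_cwave, cwave_eq, partialDeriv_solid_zero]
  simp only [solid_zero, solid_one]
  simp
  field_simp

/-- `∂₃` maps a wave to a combination of the two waves of neighbouring degrees and equal order. -/
lemma partialDeriv_two_cwave (κ : ℝ) (ε : ℂ) (m d : ℕ) :
    partialDeriv 2 (cwave κ ε m (d + 1))
      = (-(κ : ℂ) ^ 2 * (d + 2) / (2 * (m + d) + 3)) • cwave κ ε m (d + 2)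
        + ((d + 1 + 2 * m) / (2 * (m + d) + 3) : ℂ) • cwave κ ε m d := by
  funext y
  have h0 : (2 * (m + d) + 3 : ℂ) ≠ 0 := by exact_mod_cast (show 2 * (m + d) + 3 ≠ 0 by omega)
  simp only [Pi.add_apply, Pi.smul_apply, smul_eq_mul]
  rw [partialDeriv_cwave, cwave_eq, cwave_eq, partialDeriv_solid]
  have hs := solid_recurrence m d y
  have hb := besselRadial_recurrence κ (m + d) y
  simp only [← add_assoc] at hs hb ⊢
  simp
  field_simp
  push_cast at hs hb
  linear_combination (κ ^ 2 * besselRadial κ (m + d + 2) y * ((y 0 : ℂ) + ε * y 1) ^ m) * hs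
    - (d + 1 + 2 * m) * ((y 0 : ℂ) + ε * y 1) ^ m * solid m d y * hb

/-! ### The space spanned by the waves -/

/-- A space of functions that is invariant under partial derivatives and contains `j_0(κ|y|)`
contains all the waves. -/
lemma cwave_mem {κ : ℝ} (hκ : 0 < κ) (M : Submodule ℂ (R3 → ℂ))
    (hM : ∀ i, ∀ φ ∈ M, partialDeriv i φ ∈ M) (h0 : besselRadial κ 0 ∈ M)
    {ε : ℂ} (hε : ε ^ 2 = -1) (m d : ℕ) : cwave κ ε m d ∈ M := by
  have hk : (κ : ℂ) ≠ 0 := by exact_mod_cast hκ.ne'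
  have hm : ∀ m, cwave κ ε m 0 ∈ M := by
    intro m
    induction m with
    | zero =>
      convert h0 using 1
      funext y
      simp [cwave, besselRadial, solid_zero]
    | succ m ih =>
      have := M.add_mem (hM 0 _ ih) (M.smul_mem ε (hM 1 _ ih))
      rw [raise_cwave κ hε] at this
      exact (M.smul_mem_iff (neg_ne_zero.2 (pow_ne_zero 2 hk))).1 this
  induction d using Nat.strong_induction_on with
  | _ d ih =>
    match d with
    | 0 => exact hm m
    | 1 =>
      have h := hM 2 _ (hm m)
      rw [partialDeriv_two_cwave_zero] at h
      have h0 : (2 * m + 1 : ℂ) ≠ 0 := by exact_mod_cast (show 2 * m + 1 ≠ 0 by omega)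
      exact (M.smul_mem_iff (div_ne_zero (neg_ne_zero.2 (pow_ne_zero 2 hk)) h0)).1 h
    | d + 2 =>
      have h := hM 2 _ (ih (d + 1) (by omega))
      rw [partialDeriv_two_cwave] at h
      have h0 : (2 * (m + d) + 3 : ℂ) ≠ 0 := by
        exact_mod_cast (show 2 * (m + d) + 3 ≠ 0 by omega)
      have h2 : ((d : ℂ) + 2) ≠ 0 := by exact_mod_cast (show d + 2 ≠ 0 by omega)
      rw [M.add_mem_iff_left (M.smul_mem _ (ih d (by omega)))] at h
      exact (M.smul_mem_iff (div_ne_zero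
        (mul_ne_zero (neg_ne_zero.2 (pow_ne_zero 2 hk)) h2) h0)).1 h

/-- The span of the waves. -/
noncomputable def waveSpan (κ : ℝ) : Submodule ℂ (R3 → ℂ) :=
  Submodule.span ℂ {φ | ∃ ε : ℂ, ε ^ 2 = -1 ∧ ∃ m d, φ = cwave κ ε m d}

lemma cwave_mem_waveSpan (κ : ℝ) {ε : ℂ} (hε : ε ^ 2 = -1) (m d : ℕ) :
    cwave κ ε m d ∈ waveSpan κ :=
  Submodule.subset_span ⟨ε, hε, m, d, rfl⟩

lemma partialDeriv_add_fun {φ ψ : R3 → ℂ} (i : Fin 3) (hφ : ContDiff ℝ ∞ φ)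
    (hψ : ContDiff ℝ ∞ ψ) :
    partialDeriv i (φ + ψ) = partialDeriv i φ + partialDeriv i ψ :=
  funext fun y => partialDeriv_add i (ContDiff.diffAt hφ y) (ContDiff.diffAt hψ y)

lemma partialDeriv_smul_fun {φ : R3 → ℂ} (i : Fin 3) (c : ℂ) :
    partialDeriv i (c • φ) = c • partialDeriv i φ :=
  funext fun y => partialDeriv_const_mul i c y

lemma contDiff_of_mem_waveSpan {κ : ℝ} {φ : R3 → ℂ} (h : φ ∈ waveSpan κ) : ContDiff ℝ ∞ φ := by
  induction h using Submodule.span_induction with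
  | mem x hx => obtain ⟨ε, -, m, d, rfl⟩ := hx; exact contDiff_cwave κ ε m d
  | zero => exact contDiff_const
  | add x y _ _ hx hy => exact hx.add hy
  | smul a x _ hx => exact contDiff_const.mul hx

lemma partialDeriv_mem_waveSpan_of {κ : ℝ} (i : Fin 3)
    (h : ∀ ε : ℂ, ε ^ 2 = -1 → ∀ m d, partialDeriv i (cwave κ ε m d) ∈ waveSpan κ)
    {φ : R3 → ℂ} (hφ : φ ∈ waveSpan κ) : partialDeriv i φ ∈ waveSpan κ := by
  induction hφ using Submodule.span_induction with
  | mem x hx => obtain ⟨ε, hε, m, d, rfl⟩ := hx; exact h ε hε m d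
  | zero =>
    have : partialDeriv i (0 : R3 → ℂ) = 0 := funext fun y => partialDeriv_const i 0 y
    rw [this]; exact Submodule.zero_mem _
  | add x y hx hy hx' hy' =>
    rw [partialDeriv_add_fun i (contDiff_of_mem_waveSpan hx) (contDiff_of_mem_waveSpan hy)]
    exact Submodule.add_mem _ hx' hy'
  | smul a x _ hx => rw [partialDeriv_smul_fun]; exact Submodule.smul_mem _ _ hx

/-- The span of the waves is invariant under partial derivatives. -/
lemma partialDeriv_mem_waveSpan {κ : ℝ} (hκ : 0 < κ) (i : Fin 3) {φ : R3 → ℂ}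
    (hφ : φ ∈ waveSpan κ) : partialDeriv i φ ∈ waveSpan κ := by
  have hk : (κ : ℂ) ≠ 0 := by exact_mod_cast hκ.ne'
  have hz : ∀ φ ∈ waveSpan κ, partialDeriv 2 φ ∈ waveSpan κ := by
    intro φ hφ
    refine partialDeriv_mem_waveSpan_of 2 (fun ε hε m d => ?_) hφ
    rcases d with _ | d
    · rw [partialDeriv_two_cwave_zero]
      exact Submodule.smul_mem _ _ (cwave_mem_waveSpan κ hε m 1)
    · rw [partialDeriv_two_cwave]
      exact Submodule.add_mem _ (Submodule.smul_mem _ _ (cwave_mem_waveSpan κ hε m _))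
        (Submodule.smul_mem _ _ (cwave_mem_waveSpan κ hε m _))
  -- the operators `∂₁ + δ ∂₂` commute with `∂₃`, so it suffices to apply them to the waves with
  -- `d = 0`
  have hD (δ ε : ℂ) (hε : ε ^ 2 = -1) (m : ℕ)
      (hbase : partialDeriv 0 (cwave κ ε m 0) + δ • partialDeriv 1 (cwave κ ε m 0) ∈ waveSpan κ)
      (d : ℕ) :
      partialDeriv 0 (cwave κ ε m d) + δ • partialDeriv 1 (cwave κ ε m d) ∈ waveSpan κ := by
    let N : Submodule ℂ (R3 → ℂ) :=
      { carrier := {φ | ContDiff ℝ ∞ φ ∧ partialDeriv 0 φ + δ • partialDeriv 1 φ ∈ waveSpan κ}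
        add_mem' := by
          rintro a b ⟨ha, ha'⟩ ⟨hb, hb'⟩
          refine ⟨ha.add hb, ?_⟩
          rw [partialDeriv_add_fun 0 ha hb, partialDeriv_add_fun 1 ha hb]
          convert Submodule.add_mem _ ha' hb' using 1
          module
        zero_mem' := by
          refine ⟨contDiff_const, ?_⟩
          have (i : Fin 3) : partialDeriv i (0 : R3 → ℂ) = 0 :=
            funext fun y => partialDeriv_const i 0 y
          rw [this, this, smul_zero, add_zero]
          exact Submodule.zero_mem _
        smul_mem' := by
          rintro c a ⟨ha, ha'⟩
          refine ⟨contDiff_const.mul ha, ?_⟩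
          rw [partialDeriv_smul_fun, partialDeriv_smul_fun]
          convert Submodule.smul_mem _ c ha' using 1
          module }
    have hN2 : ∀ φ ∈ N, partialDeriv 2 φ ∈ N := by
      rintro φ ⟨h1, h2⟩
      refine ⟨ContDiff.partialDeriv h1 2, ?_⟩
      have := hz _ h2
      rw [partialDeriv_add_fun (ψ := δ • Maxwell.partialDeriv 1 φ) 2 (ContDiff.partialDeriv h1 0)
        ((ContDiff.partialDeriv h1 1).const_smul δ), partialDeriv_smul_fun,
        partialDeriv_comm h1 2 0, partialDeriv_comm h1 2 1] at this
      exact this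
    suffices cwave κ ε m d ∈ N from this.2
    induction d using Nat.strong_induction_on with
    | _ d ih =>
      match d with
      | 0 => exact ⟨contDiff_cwave κ ε m 0, hbase⟩
      | 1 =>
        have h := hN2 _ (ih 0 (by omega))
        rw [partialDeriv_two_cwave_zero] at h
        have h0 : (2 * m + 1 : ℂ) ≠ 0 := by exact_mod_cast (show 2 * m + 1 ≠ 0 by omega)
        exact (N.smul_mem_iff (div_ne_zero (neg_ne_zero.2 (pow_ne_zero 2 hk)) h0)).1 h
      | d + 2 =>
        have h := hN2 _ (ih (d + 1) (by omega))
        rw [partialDeriv_two_cwave] at h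
        have h0 : (2 * (m + d) + 3 : ℂ) ≠ 0 := by
          exact_mod_cast (show 2 * (m + d) + 3 ≠ 0 by omega)
        have h2 : ((d : ℂ) + 2) ≠ 0 := by exact_mod_cast (show d + 2 ≠ 0 by omega)
        rw [N.add_mem_iff_left (N.smul_mem _ (ih d (by omega)))] at h
        exact (N.smul_mem_iff (div_ne_zero
          (mul_ne_zero (neg_ne_zero.2 (pow_ne_zero 2 hk)) h2) h0)).1 h
  have hplus (ε : ℂ) (hε : ε ^ 2 = -1) (m d : ℕ) :
      partialDeriv 0 (cwave κ ε m d) + ε • partialDeriv 1 (cwave κ ε m d) ∈ waveSpan κ := by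
    refine hD ε ε hε m ?_ d
    rw [raise_cwave κ hε]
    exact Submodule.smul_mem _ _ (cwave_mem_waveSpan κ hε _ _)
  have hminus (ε : ℂ) (hε : ε ^ 2 = -1) (m d : ℕ) :
      partialDeriv 0 (cwave κ ε m d) + (-ε) • partialDeriv 1 (cwave κ ε m d) ∈ waveSpan κ := by
    refine hD (-ε) ε hε m ?_ d
    rcases m with _ | m
    · -- for `m = 0` the wave does not depend on `ε`
      have h : cwave κ ε 0 0 = cwave κ (-ε) 0 0 := by funext y; simp [cwave]
      have hε' : (-ε) ^ 2 = -1 := by rw [neg_sq, hε]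
      rw [h, raise_cwave κ hε']
      exact Submodule.smul_mem _ _ (cwave_mem_waveSpan κ hε' _ _)
    · rw [lower_cwave hε]
      exact Submodule.sub_mem _ (cwave_mem_waveSpan κ hε _ _)
        (Submodule.smul_mem _ _ (hz _ (cwave_mem_waveSpan κ hε _ _)))
  have hεne (ε : ℂ) (hε : ε ^ 2 = -1) : ε ≠ 0 := by
    rintro rfl; norm_num at hε
  refine partialDeriv_mem_waveSpan_of i (fun ε hε m d => ?_) hφ
  have hp := hplus ε hε m d
  have hmi := hminus ε hε m d
  match i with
  | 0 =>
    convert Submodule.smul_mem _ (2⁻¹ : ℂ) (Submodule.add_mem _ hp hmi) using 1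
    module
  | 1 =>
    convert Submodule.smul_mem _ ((2 * ε)⁻¹ : ℂ) (Submodule.sub_mem _ hp hmi) using 1
    have := hεne ε hε
    funext y
    simp only [Pi.smul_apply, Pi.sub_apply, Pi.add_apply, smul_eq_mul]
    field_simp
    ring
  | 2 => exact hz _ (cwave_mem_waveSpan κ hε m d)

/-! ### Integrals depending on a parameter -/

lemma InL2.integrableOn {V : Type*} [NormedAddCommGroup V] {R : ℝ} {u : R3 → V}
    (h : InL2 R u) : IntegrableOn u (ball 0 R) :=
  haveI : IsFiniteMeasure (volume.restrict (ball (0 : R3) R)) :=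
    ⟨by simpa using measure_ball_lt_top (μ := (volume : Measure R3)) (x := 0) (r := R)⟩
  MemLp.integrable (by norm_num) h

lemma integrableOn_coord {R : ℝ} {J : R3 → C3} (hJ : IntegrableOn J (ball 0 R)) (s : Fin 3) :
    IntegrableOn (fun y => J y s) (ball 0 R) :=
  (EuclideanSpace.proj (𝕜 := ℂ) s).integrable_comp hJ

lemma integrableOn_mul_of_continuousOn {R : ℝ} {e j : R3 → ℂ}
    (he : ContinuousOn e (closedBall 0 R)) (hj : IntegrableOn j (ball 0 R)) :
    IntegrableOn (fun y => e y * j y) (ball 0 R) := by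
  obtain ⟨C, hC⟩ := (isCompact_closedBall (0 : R3) R).exists_bound_of_continuousOn he
  refine Integrable.bdd_mul (c := C) hj
    ((he.mono ball_subset_closedBall).aestronglyMeasurable measurableSet_ball) ?_
  exact (ae_restrict_iff' measurableSet_ball).2
    (Filter.Eventually.of_forall fun y hy => hC y (ball_subset_closedBall hy))

lemma apply_apply (M : Matrix (Fin 3) (Fin 3) ℂ) (v : C3) (l : Fin 3) :
    apply M v l = ∑ s, M l s * v s := by
  simp [apply, Matrix.mulVec, dotProduct]

lemma integrable_apply_coord {R : ℝ} {J : R3 → C3} {M : R3 → Matrix (Fin 3) (Fin 3) ℂ}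
    (hM : ∀ l s, ContinuousOn (fun y => M y l s) (closedBall 0 R))
    (hJ : IntegrableOn J (ball 0 R)) (l : Fin 3) :
    IntegrableOn (fun y => apply (M y) (J y) l) (ball 0 R) := by
  simp only [apply_apply]
  exact integrable_finsetSum _ fun s _ =>
    integrableOn_mul_of_continuousOn (hM l s) (integrableOn_coord hJ s)

lemma integrable_apply {R : ℝ} {J : R3 → C3} {M : R3 → Matrix (Fin 3) (Fin 3) ℂ}
    (hM : ∀ l s, ContinuousOn (fun y => M y l s) (closedBall 0 R))
    (hJ : IntegrableOn J (ball 0 R)) :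
    IntegrableOn (fun y => apply (M y) (J y)) (ball 0 R) :=
  Integrable.of_eval_piLp (fun l => integrable_apply_coord hM hJ l)

lemma integral_apply_coord {R : ℝ} {J : R3 → C3} {M : R3 → Matrix (Fin 3) (Fin 3) ℂ}
    (hM : ∀ l s, ContinuousOn (fun y => M y l s) (closedBall 0 R))
    (hJ : IntegrableOn J (ball 0 R)) (l : Fin 3) :
    (∫ y in ball (0 : R3) R, apply (M y) (J y)) l
      = ∑ s, ∫ y in ball (0 : R3) R, M y l s * J y s := by
  rw [eval_integral_piLp (fun l => integrable_apply_coord hM hJ l)]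
  simp only [apply_apply]
  exact integral_finsetSum _ fun s _ =>
    integrableOn_mul_of_continuousOn (hM l s) (integrableOn_coord hJ s)

/-- Differentiation under the integral sign over the ball. -/
lemma hasDerivAt_setIntegral_mul {𝕜 : Type*} [RCLike 𝕜] [NormedAlgebra 𝕜 ℂ] {R C : ℝ}
    {m m' : 𝕜 → R3 → ℂ} {j : R3 → ℂ} {U : Set 𝕜} {t₀ : 𝕜} (hU : U ∈ nhds t₀)
    (hc : ∀ t ∈ U, ContinuousOn (m t) (closedBall 0 R))
    (hC : ∀ t ∈ U, ∀ y ∈ ball (0 : R3) R, ‖m' t y‖ ≤ C)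
    (hd : ∀ t ∈ U, ∀ y ∈ ball (0 : R3) R, HasDerivAt (fun t => m t y) (m' t y) t)
    (hj : IntegrableOn j (ball 0 R)) :
    HasDerivAt (fun t => ∫ y in ball (0 : R3) R, m t y * j y)
      (∫ y in ball (0 : R3) R, m' t₀ y * j y) t₀ := by
  have hae {p : R3 → Prop} (h : ∀ y ∈ ball (0 : R3) R, p y) :
      ∀ᵐ y ∂(volume.restrict (ball (0 : R3) R)), p y :=
    (ae_restrict_iff' measurableSet_ball).2 (Filter.Eventually.of_forall h)
  have ht₀ : t₀ ∈ U := mem_of_mem_nhds hU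
  have hmeas : ∀ t ∈ U, AEStronglyMeasurable (m t) (volume.restrict (ball (0 : R3) R)) :=
    fun t ht => ((hc t ht).mono ball_subset_closedBall).aestronglyMeasurable measurableSet_ball
  -- the derivative is measurable as a limit of difference quotients
  have hm' : AEStronglyMeasurable (m' t₀) (volume.restrict (ball (0 : R3) R)) := by
    classical
    refine aestronglyMeasurable_of_tendsto_ae (nhdsWithin t₀ {t₀}ᶜ)
      (f := fun t y => if t ∈ U then slope (fun t => m t y) t₀ t else 0) (fun t => ?_)
      (hae fun y hy => ?_)
    · by_cases h : t ∈ U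
      · simp only [h, if_true, slope_def_module]
        exact ((hmeas t h).sub (hmeas t₀ ht₀)).const_smul _
      · simp only [h, if_false]; exact aestronglyMeasurable_const
    · refine ((hd t₀ ht₀ y hy).tendsto_slope).congr' ?_
      filter_upwards [mem_nhdsWithin_of_mem_nhds hU] with t ht
      simp [ht]
  refine (hasDerivAt_integral_of_dominated_loc_of_deriv_le (F' := fun t y => m' t y * j y)
    (bound := fun y => C * ‖j y‖) hU ?_ ?_ (hm'.mul hj.aestronglyMeasurable) ?_
    (hj.norm.const_mul C) ?_).2
  · filter_upwards [hU] with t ht using (hmeas t ht).mul hj.aestronglyMeasurable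
  · exact integrableOn_mul_of_continuousOn (hc t₀ ht₀) hj
  · refine hae fun y hy t ht => ?_
    rw [norm_mul]
    exact mul_le_mul_of_nonneg_right (hC t ht y hy) (norm_nonneg _)
  · exact hae fun y hy t ht => (hd t ht y hy).mul_const _

/-- The integral of a holomorphic family of functions is holomorphic. -/
lemma differentiableOn_setIntegral_mul {R : ℝ} {m : ℂ → R3 → ℂ} {j : R3 → ℂ} {U : Set ℂ}
    (hU : IsOpen U) (hc : ContinuousOn (fun p : ℂ × R3 => m p.1 p.2) (U ×ˢ closedBall 0 R))
    (hd : ∀ y ∈ ball (0 : R3) R, DifferentiableOn ℂ (fun t => m t y) U)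
    (hj : IntegrableOn j (ball 0 R)) :
    DifferentiableOn ℂ (fun t => ∫ y in ball (0 : R3) R, m t y * j y) U := by
  intro t₀ ht₀
  obtain ⟨r, hr, hrU⟩ := Metric.nhds_basis_closedBall.mem_iff.1 (hU.mem_nhds ht₀)
  have hr2 : 0 < r / 2 := by positivity
  obtain ⟨C, hC⟩ := ((isCompact_closedBall t₀ r).prod
    (isCompact_closedBall (0 : R3) R)).exists_bound_of_continuousOn
      (hc.mono (Set.prod_mono hrU subset_rfl))
  have hsub : ∀ t ∈ ball t₀ (r / 2), closedBall t (r / 2) ⊆ closedBall t₀ r := by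
    intro t ht
    refine closedBall_subset_closedBall' ?_
    rw [mem_ball] at ht; linarith
  have hballU : ball t₀ (r / 2) ⊆ U :=
    (ball_subset_ball (by linarith)).trans (ball_subset_closedBall.trans hrU)
  refine (hasDerivAt_setIntegral_mul (U := ball t₀ (r / 2)) (C := C / (r / 2))
    (m' := fun t y => deriv (fun t => m t y) t) (ball_mem_nhds t₀ hr2) (fun t ht => ?_)
    (fun t ht y hy => ?_) (fun t ht y hy => ?_) hj).differentiableAt.differentiableWithinAt
  · have hp : ContinuousOn (fun y : R3 => (t, y)) (closedBall 0 R) :=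
      (Continuous.prodMk_right t).continuousOn
    exact hc.comp hp fun y hy => ⟨hballU ht, hy⟩
  · refine Complex.norm_deriv_le_of_forall_mem_sphere_norm_le hr2 ?_ fun z hz => ?_
    · exact ((hd y hy).mono ((hsub t ht).trans hrU)).diffContOnCl_ball subset_rfl
    · exact hC (z, y) ⟨hsub t ht (sphere_subset_closedBall hz), ball_subset_closedBall hy⟩
  · exact ((hd y hy).differentiableAt (hU.mem_nhds (hballU ht))).hasDerivAt

/-- The identity theorem for a holomorphic function that vanishes on a real interval. -/
lemma eqOn_zero_of_eventually_ofReal {f : ℂ → ℂ} {U : Set ℂ} (hU : IsOpen U)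
    (hU' : IsPreconnected U) (hf : DifferentiableOn ℂ f U) {t₀ : ℝ} (ht₀ : (t₀ : ℂ) ∈ U)
    (h : ∀ᶠ t : ℝ in nhds t₀, f t = 0) : Set.EqOn f 0 U := by
  refine (hf.analyticOnNhd hU).eqOn_zero_of_preconnected_of_frequently_eq_zero hU' ht₀ ?_
  have ht : Filter.Tendsto (fun t : ℝ => (t : ℂ)) (nhdsWithin t₀ {t₀}ᶜ)
      (nhdsWithin (t₀ : ℂ) {(t₀ : ℂ)}ᶜ) := by
    refine tendsto_nhdsWithin_iff.2 ⟨?_, ?_⟩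
    · exact (Complex.continuous_ofReal.tendsto t₀).mono_left nhdsWithin_le_nhds
    · filter_upwards [self_mem_nhdsWithin] with t ht
      simpa using ht
  exact ht.frequently (Filter.Eventually.frequently (mem_nhdsWithin_of_mem_nhds h))

/-! ### Moments against translates of the standing wave `j_0(κ|y|)` -/

/-- The moment `∫_{B_R} ((I + κ⁻² ∇∇) φ) J dy`. -/
noncomputable def moment (κ R : ℝ) (J : R3 → C3) (φ : R3 → ℂ) : C3 :=
  ∫ y in ball (0 : R3) R, apply (dyad κ φ y) (J y)

lemma moment_coord {κ R : ℝ} {J : R3 → C3} (hJ : IntegrableOn J (ball 0 R)) {φ : R3 → ℂ}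
    (hφ : ContDiff ℝ ∞ φ) (l : Fin 3) :
    moment κ R J φ l = ∑ s, ∫ y in ball (0 : R3) R, dyad κ φ y l s * J y s :=
  integral_apply_coord (fun l s => (contDiff_dyad κ hφ l s).continuous.continuousOn) hJ l

lemma moment_add {κ R : ℝ} {J : R3 → C3} (hJ : IntegrableOn J (ball 0 R)) {φ ψ : R3 → ℂ}
    (hφ : ContDiff ℝ ∞ φ) (hψ : ContDiff ℝ ∞ ψ) :
    moment κ R J (φ + ψ) = moment κ R J φ + moment κ R J ψ := by
  have hi {φ : R3 → ℂ} (hφ : ContDiff ℝ ∞ φ) :=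
    integrable_apply (fun l s => (contDiff_dyad κ hφ l s).continuous.continuousOn) hJ
  simp only [moment]
  rw [← integral_add (hi hφ) (hi hψ)]
  congr 1
  funext y
  rw [show φ + ψ = fun y => φ y + ψ y from rfl, dyad_add κ hφ hψ]
  simp [apply, Matrix.add_mulVec]

lemma moment_smul {κ R : ℝ} {J : R3 → C3} (c : ℂ) (φ : R3 → ℂ) :
    moment κ R J (c • φ) = c • moment κ R J φ := by
  simp only [moment]
  rw [← integral_smul]
  congr 1
  funext y
  rw [show c • φ = fun y => c * φ y from rfl, dyad_const_mul]
  simp [apply, Matrix.smul_mulVec]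

lemma moment_zero {κ R : ℝ} {J : R3 → C3} : moment κ R J 0 = 0 := by
  have := moment_smul (κ := κ) (R := R) (J := J) 0 0
  simpa using this

/-- The directional derivative `b·∇φ`. -/
noncomputable def dirDeriv (b : R3) (φ : R3 → ℂ) : R3 → ℂ :=
  ∑ i, (b i : ℂ) • partialDeriv i φ

lemma fderiv_eq_dirDeriv {φ : R3 → ℂ} (b v : R3) : fderiv ℝ φ v b = dirDeriv b φ v := by
  have hb : b = ∑ i, b i • EuclideanSpace.single i (1 : ℝ) := by
    ext j; simp [Finset.sum_apply, Pi.single_apply]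
  conv_lhs => rw [hb]
  simp only [map_sum, map_smul, dirDeriv, Finset.sum_apply, Pi.smul_apply, partialDeriv,
    Complex.real_smul, smul_eq_mul]

lemma contDiff_dirDeriv {φ : R3 → ℂ} (b : R3) (hφ : ContDiff ℝ ∞ φ) :
    ContDiff ℝ ∞ (dirDeriv b φ) := by
  simp only [dirDeriv, Fin.sum_univ_three]
  exact (((ContDiff.partialDeriv hφ 0).const_smul (b 0 : ℂ)).add
    ((ContDiff.partialDeriv hφ 1).const_smul (b 1 : ℂ))).add
      ((ContDiff.partialDeriv hφ 2).const_smul (b 2 : ℂ))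

lemma dyad_dirDeriv {φ : R3 → ℂ} (κ : ℝ) (b : R3) (hφ : ContDiff ℝ ∞ φ) (v : R3) (l s : Fin 3) :
    dyad κ (dirDeriv b φ) v l s = dirDeriv b (fun v => dyad κ φ v l s) v := by
  have hp (i : Fin 3) := ContDiff.partialDeriv hφ i
  have hs (i : Fin 3) (c : ℂ) : ContDiff ℝ ∞ (fun y => c * partialDeriv i φ y) :=
    contDiff_const.mul (hp i)
  have h : dirDeriv b φ = fun y => ((b 0 : ℂ) * partialDeriv 0 φ y
      + (b 1 : ℂ) * partialDeriv 1 φ y) + (b 2 : ℂ) * partialDeriv 2 φ y := by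
    funext y; simp [dirDeriv, Fin.sum_univ_three]
  rw [h, dyad_add κ ((hs 0 _).add (hs 1 _)) (hs 2 _), dyad_add κ (hs 0 _) (hs 1 _),
    dyad_const_mul, dyad_const_mul, dyad_const_mul]
  simp only [Matrix.add_apply, Matrix.smul_apply, dirDeriv, Fin.sum_univ_three, Pi.add_apply,
    Pi.smul_apply, partialDeriv_dyad κ hφ]

/-- The moment against the translate of `φ` by `a`. -/
noncomputable def shiftMoment (κ R : ℝ) (J : R3 → C3) (φ : R3 → ℂ) (a : R3) : C3 :=
  moment κ R J fun y => φ (y - a)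

lemma contDiff_shift {φ : R3 → ℂ} (hφ : ContDiff ℝ ∞ φ) (a : R3) :
    ContDiff ℝ ∞ (fun y => φ (y - a)) :=
  hφ.comp (contDiff_id.sub contDiff_const)

lemma shiftMoment_coord {κ R : ℝ} {J : R3 → C3} (hJ : IntegrableOn J (ball 0 R)) {φ : R3 → ℂ}
    (hφ : ContDiff ℝ ∞ φ) (a : R3) (l : Fin 3) :
    shiftMoment κ R J φ a l = ∑ s, ∫ y in ball (0 : R3) R, dyad κ φ (y - a) l s * J y s := by
  rw [shiftMoment, moment_coord hJ (contDiff_shift hφ a)]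
  simp only [dyad_comp_sub]

lemma hasDerivAt_shiftMoment {κ R : ℝ} {J : R3 → C3} (hJ : IntegrableOn J (ball 0 R))
    {φ : R3 → ℂ} (hφ : ContDiff ℝ ∞ φ) (a b : R3) (l : Fin 3) (t : ℝ) :
    HasDerivAt (fun t : ℝ => shiftMoment κ R J φ (a + t • b) l)
      (-shiftMoment κ R J (dirDeriv b φ) (a + t • b) l) t := by
  simp only [shiftMoment_coord hJ hφ, shiftMoment_coord hJ (contDiff_dirDeriv b hφ)]
  rw [← Finset.sum_neg_distrib]
  refine HasDerivAt.fun_sum fun s _ => ?_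
  rw [← integral_neg]
  simp only [← neg_mul]
  have hcont : Continuous fun p : ℝ × R3 => -dyad κ (dirDeriv b φ) (p.2 - (a + p.1 • b)) l s :=
    ((contDiff_dyad κ (contDiff_dirDeriv b hφ) l s).continuous.comp (by fun_prop)).neg
  obtain ⟨C, hC⟩ := ((isCompact_closedBall t 1).prod
    (isCompact_closedBall (0 : R3) R)).exists_bound_of_continuousOn hcont.continuousOn
  refine hasDerivAt_setIntegral_mul (U := closedBall t 1) (C := C)
    (m := fun t y => dyad κ φ (y - (a + t • b)) l s)
    (m' := fun t y => -dyad κ (dirDeriv b φ) (y - (a + t • b)) l s)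
    (closedBall_mem_nhds t one_pos) (fun t _ => ?_)
    (fun t ht y hy => hC (t, y) ⟨ht, ball_subset_closedBall hy⟩) (fun t _ y _ => ?_)
    (integrableOn_coord hJ s)
  · exact ((contDiff_dyad κ hφ l s).continuous.comp (by fun_prop)).continuousOn
  · have h1 : HasDerivAt (fun t : ℝ => y - (a + t • b)) (-b) t := by
      have := (((hasDerivAt_id t).smul_const b).const_add a).const_sub y
      simpa using this
    have h2 := (ContDiff.diffAt (contDiff_dyad κ hφ l s)
      (y - (a + t • b))).hasFDerivAt.comp_hasDerivAt t h1
    rw [map_neg, fderiv_eq_dirDeriv, ← dyad_dirDeriv κ b hφ] at h2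
    exact h2

lemma dyad_besselRadial {κ : ℝ} (hκ : 0 < κ) (v : R3) (l s : Fin 3) :
    dyad κ (besselRadial κ 0) v l s
      = (if l = s then besselRadial κ 0 v - besselRadial κ 1 v else 0)
        + κ ^ 2 * (v l * v s) * besselRadial κ 2 v := by
  have hk : (κ : ℂ) ≠ 0 := by exact_mod_cast hκ.ne'
  have h : partialDeriv s (besselRadial κ 0) = fun y => -κ ^ 2 * (y s * besselRadial κ 1 y) := by
    funext y; rw [partialDeriv_besselRadial]; ring
  rw [dyad_apply, h, partialDeriv_const_mul, partialDeriv_mul _ (differentiableAt_coord s v)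
    (ContDiff.diffAt (contDiff_besselRadial κ 1) v), partialDeriv_coord, partialDeriv_besselRadial]
  by_cases hls : l = s
  · subst hls; simp; field_simp; ring
  · simp [hls, Ne.symm hls]; field_simp

/-- The function `t ↦ ∫_{B_R} ((I + κ⁻² ∇∇) j_0(κ|y - tb|)) J dy` is the restriction to the real
line of an entire function. -/
lemma exists_entire_shiftMoment {κ R : ℝ} (hκ : 0 < κ) {J : R3 → C3}
    (hJ : IntegrableOn J (ball 0 R)) (b : R3) (l : Fin 3) :
    ∃ h : ℂ → ℂ, Differentiable ℂ h ∧
      ∀ t : ℝ, h t = shiftMoment κ R J (besselRadial κ 0) (t • b) l := by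
  let v (t : ℂ) (y : R3) (i : Fin 3) : ℂ := y i - t * b i
  let q (t : ℂ) (y : R3) : ℂ := κ ^ 2 * ∑ i, v t y i ^ 2
  let N (s : Fin 3) (t : ℂ) (y : R3) : ℂ :=
    (if l = s then 1 else 0) * (besselEntire 0 (q t y) - besselEntire 1 (q t y))
      + κ ^ 2 * (v t y l * v t y s) * besselEntire 2 (q t y)
  have hJc (n : ℕ) := (differentiable_besselEntire n).continuous
  refine ⟨fun t => ∑ s, ∫ y in ball (0 : R3) R, N s t y * J y s, ?_, fun t => ?_⟩
  · refine Differentiable.fun_sum fun s _ => ?_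
    rw [← differentiableOn_univ]
    refine differentiableOn_setIntegral_mul isOpen_univ (Continuous.continuousOn ?_)
      (fun y _ => Differentiable.differentiableOn ?_) (integrableOn_coord hJ s)
    · have hq : Continuous fun p : ℂ × R3 => q p.1 p.2 := by
        simp only [q, v]; fun_prop
      have h0 := (hJc 0).comp hq
      have h1 := (hJc 1).comp hq
      have h2 := (hJc 2).comp hq
      simp only [N, v]
      refine (continuous_const.mul (h0.sub h1)).add (Continuous.mul ?_ h2)
      fun_prop
    · have hq : Differentiable ℂ fun t : ℂ => q t y := by
        simp only [q, v]; fun_prop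
      have h0 := (differentiable_besselEntire 0).comp hq
      have h1 := (differentiable_besselEntire 1).comp hq
      have h2 := (differentiable_besselEntire 2).comp hq
      simp only [N, v]
      refine ((differentiable_const _).mul (h0.sub h1)).add (Differentiable.mul ?_ h2)
      fun_prop
  · rw [shiftMoment_coord hJ (contDiff_besselRadial κ 0)]
    refine Finset.sum_congr rfl fun s _ => ?_
    congr 1
    funext y
    have hq : q t y = ((κ ^ 2 * ‖y - t • b‖ ^ 2 : ℝ) : ℂ) := by
      simp only [q, v, EuclideanSpace.real_norm_sq_eq]
      simp
    rw [dyad_besselRadial hκ]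
    simp only [N, hq, v, besselRadial]
    split_ifs <;> simp

/-- By analyticity along lines through the origin, the moments against the translates of
`j_0(κ|y|)` vanish for all translations if they do so outside the ball. -/
lemma shiftMoment_eq_zero_of_forall_norm_gt {κ R : ℝ} (hκ : 0 < κ) (hR : 0 < R) {J : R3 → C3}
    (hJ : IntegrableOn J (ball 0 R))
    (h : ∀ a : R3, R < ‖a‖ → shiftMoment κ R J (besselRadial κ 0) a = 0) (a : R3) :
    shiftMoment κ R J (besselRadial κ 0) a = 0 := by
  have key (b : R3) (hb : b ≠ 0) (t : ℝ) : shiftMoment κ R J (besselRadial κ 0) (t • b) = 0 := by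
    ext l
    obtain ⟨f, hf, hft⟩ := exists_entire_shiftMoment hκ hJ b l
    have hbn : 0 < ‖b‖ := norm_pos_iff.2 hb
    have := eqOn_zero_of_eventually_ofReal (t₀ := R / ‖b‖ + 1) isOpen_univ
      isPreconnected_univ hf.differentiableOn (Set.mem_univ _) (by
        filter_upwards [lt_mem_nhds (lt_add_one (R / ‖b‖))] with t ht
        rw [hft, h]
        · rfl
        · have : R < t * ‖b‖ := (div_lt_iff₀ hbn).1 ht
          have ht0 : 0 < t := lt_trans (by positivity) ht
          rwa [norm_smul, Real.norm_of_nonneg ht0.le])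
    rw [← hft]
    exact this (Set.mem_univ _)
  rcases eq_or_ne a 0 with rfl | ha
  · have := key (EuclideanSpace.single 0 1) (by simp) 0
    rwa [zero_smul] at this
  · have := key a ha 1
    rwa [one_smul] at this

/-- The functions whose translates all have vanishing moment form a space that is invariant under
derivatives, so it contains all the waves as soon as it contains `j_0(κ|y|)`. -/
lemma moment_cwave_eq_zero_of_shiftMoment {κ R : ℝ} (hκ : 0 < κ) {J : R3 → C3}
    (hJ : IntegrableOn J (ball 0 R))
    (h : ∀ a : R3, shiftMoment κ R J (besselRadial κ 0) a = 0) {ε : ℂ} (hε : ε ^ 2 = -1)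
    (m d : ℕ) : moment κ R J (cwave κ ε m d) = 0 := by
  let M : Submodule ℂ (R3 → ℂ) :=
    { carrier := {φ | ContDiff ℝ ∞ φ ∧ ∀ a, shiftMoment κ R J φ a = 0}
      add_mem' := by
        rintro φ ψ ⟨h1, h2⟩ ⟨h3, h4⟩
        refine ⟨h1.add h3, fun a => ?_⟩
        have := moment_add (κ := κ) hJ (contDiff_shift h1 a) (contDiff_shift h3 a)
        have e1 := h2 a
        have e2 := h4 a
        simp only [shiftMoment] at e1 e2 ⊢
        rw [e1, e2, add_zero] at this
        exact this
      zero_mem' := ⟨contDiff_const, fun a => moment_zero⟩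
      smul_mem' := by
        rintro c φ ⟨h1, h2⟩
        refine ⟨contDiff_const.mul h1, fun a => ?_⟩
        have := moment_smul (κ := κ) (R := R) (J := J) c (fun y => φ (y - a))
        have e1 := h2 a
        simp only [shiftMoment] at e1 ⊢
        rw [e1, smul_zero] at this
        exact this }
  have hmem : cwave κ ε m d ∈ M := by
    refine cwave_mem hκ M ?_ ⟨contDiff_besselRadial κ 0, h⟩ hε m d
    rintro i φ ⟨h1, h2⟩
    refine ⟨ContDiff.partialDeriv h1 i, fun a => ?_⟩
    ext l
    have hd := hasDerivAt_shiftMoment (κ := κ) hJ h1 a (EuclideanSpace.single i 1) l 0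
    have hdir : dirDeriv (EuclideanSpace.single i 1) φ = partialDeriv i φ := by
      funext y; rw [← fderiv_eq_dirDeriv]; rfl
    simp only [h2] at hd
    rw [hdir, zero_smul, add_zero] at hd
    have := hd.unique (hasDerivAt_const (0 : ℝ) _)
    simpa using this
  have := hmem.2 0
  simpa [shiftMoment] using this

/-- If the moments against the waves vanish, then so do all Taylor coefficients at `0` of
`t ↦ shiftMoment (tb)`, because the span of the waves is invariant under derivatives. -/
lemma shiftMoment_eq_zero_of_moment_cwave {κ R : ℝ} (hκ : 0 < κ) {J : R3 → C3}
    (hJ : IntegrableOn J (ball 0 R))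
    (h : ∀ ε : ℂ, ε ^ 2 = -1 → ∀ m d, moment κ R J (cwave κ ε m d) = 0) (b : R3) :
    shiftMoment κ R J (besselRadial κ 0) b = 0 := by
  have hspan {φ : R3 → ℂ} (hφ : φ ∈ waveSpan κ) : moment κ R J φ = 0 := by
    induction hφ using Submodule.span_induction with
    | mem x hx => obtain ⟨ε, hε, m, d, rfl⟩ := hx; exact h ε hε m d
    | zero => exact moment_zero
    | add x y hx hy hx' hy' =>
      rw [moment_add hJ (contDiff_of_mem_waveSpan hx) (contDiff_of_mem_waveSpan hy), hx', hy',
        add_zero]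
    | smul a x _ hx => rw [moment_smul, hx, smul_zero]
  have hφ (k : ℕ) : (dirDeriv b)^[k] (besselRadial κ 0) ∈ waveSpan κ := by
    induction k with
    | zero =>
      have : besselRadial κ 0 = cwave κ Complex.I 0 0 := by
        funext y; simp [cwave, besselRadial, solid_zero]
      rw [Function.iterate_zero_apply, this]
      exact cwave_mem_waveSpan κ Complex.I_sq 0 0
    | succ k ih =>
      rw [Function.iterate_succ_apply']
      exact Submodule.sum_mem _ fun i _ =>
        Submodule.smul_mem _ _ (partialDeriv_mem_waveSpan hκ i ih)
  ext l
  obtain ⟨f, hf, hft⟩ := exists_entire_shiftMoment hκ hJ b l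
  have hiter (k : ℕ) (t : ℝ) : iteratedDeriv k f t
      = (-1) ^ k * shiftMoment κ R J ((dirDeriv b)^[k] (besselRadial κ 0)) (t • b) l := by
    induction k generalizing t with
    | zero => simp [hft]
    | succ k ih =>
      have h1 : HasDerivAt (iteratedDeriv k f) (iteratedDeriv (k + 1) f t) (t : ℂ) := by
        rw [iteratedDeriv_succ]
        exact (((hf.contDiff (n := ∞)).differentiable_iteratedDeriv k (by
          exact_mod_cast WithTop.coe_lt_top k)) t).hasDerivAt
      have h2 := h1.comp_ofReal
      have h3 := (hasDerivAt_shiftMoment (κ := κ) hJ (contDiff_of_mem_waveSpan (hφ k)) 0 b l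
        t).const_mul ((-1 : ℂ) ^ k)
      simp only [zero_add] at h3
      simp only [ih] at h2
      rw [h2.unique h3, Function.iterate_succ_apply']
      ring
  have hz (k : ℕ) : iteratedDeriv k f 0 = 0 := by
    have := hiter k 0
    rw [zero_smul, Complex.ofReal_zero] at this
    rw [this, shiftMoment]
    simp only [sub_zero]
    rw [hspan (hφ k)]
    simp
  have := Complex.taylorSeries_eq_of_entire' 0 1 hf
  simp only [hz] at this
  have h1 := hft 1
  rw [one_smul, Complex.ofReal_one, ← this] at h1
  rw [← h1]
  simp

/-! ### The dyadic Green's tensor -/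

/-- The profile `exp(iκr) / (4πr)` of the Green's function, as a function of `q = r²`. -/
noncomputable def greenProfile (κ q : ℝ) : ℂ :=
  Complex.exp (Complex.I * κ * (Real.sqrt q : ℝ)) / (4 * Real.pi * (Real.sqrt q : ℝ))

/-- The derivative of `greenProfile` in `q`. -/
noncomputable def greenProfile' (κ q : ℝ) : ℂ :=
  Complex.exp (Complex.I * κ * (Real.sqrt q : ℝ)) * (Complex.I * κ * (Real.sqrt q : ℝ) - 1)
    / (8 * Real.pi * (Real.sqrt q : ℝ) ^ 3)

/-- The second derivative of `greenProfile` in `q`. -/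
noncomputable def greenProfile'' (κ q : ℝ) : ℂ :=
  Complex.exp (Complex.I * κ * (Real.sqrt q : ℝ))
    * (-κ ^ 2 * (Real.sqrt q : ℝ) ^ 2 - 3 * Complex.I * κ * (Real.sqrt q : ℝ) + 3)
    / (16 * Real.pi * (Real.sqrt q : ℝ) ^ 5)

lemma hasDerivAt_comp_sqrt {G : ℂ → ℂ} {G' : ℂ} {q : ℝ} (hq : 0 < q)
    (hG : HasDerivAt G G' ((Real.sqrt q : ℝ) : ℂ)) :
    HasDerivAt (fun q : ℝ => G ((Real.sqrt q : ℝ) : ℂ)) (G' * (1 / (2 * (Real.sqrt q : ℝ)))) q := by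
  have h1 := (Real.hasDerivAt_sqrt hq.ne').ofReal_comp
  refine (hG.comp q h1).congr_deriv ?_
  push_cast; ring

lemma hasDerivAt_greenProfile (κ : ℝ) {q : ℝ} (hq : 0 < q) :
    HasDerivAt (greenProfile κ) (greenProfile' κ q) q := by
  have hr : ((Real.sqrt q : ℝ) : ℂ) ≠ 0 := by exact_mod_cast (Real.sqrt_pos.2 hq).ne'
  have hpi : (Real.pi : ℂ) ≠ 0 := by exact_mod_cast Real.pi_ne_zero
  set r : ℂ := ((Real.sqrt q : ℝ) : ℂ) with hrdef
  have he : HasDerivAt (fun z : ℂ => Complex.exp (Complex.I * κ * z))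
      (Complex.exp (Complex.I * κ * r) * (Complex.I * κ)) r := by
    simpa using ((hasDerivAt_id r).const_mul (Complex.I * κ)).cexp
  have hden : HasDerivAt (fun z : ℂ => 4 * Real.pi * z) (4 * Real.pi) r := by
    simpa using (hasDerivAt_id r).const_mul (4 * Real.pi : ℂ)
  have h := hasDerivAt_comp_sqrt hq (he.fun_div hden (by simp [hpi, hr]))
  refine h.congr_deriv ?_
  rw [greenProfile', ← hrdef]
  field_simp
  ring

lemma hasDerivAt_greenProfile' (κ : ℝ) {q : ℝ} (hq : 0 < q) :
    HasDerivAt (greenProfile' κ) (greenProfile'' κ q) q := by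
  have hr : ((Real.sqrt q : ℝ) : ℂ) ≠ 0 := by exact_mod_cast (Real.sqrt_pos.2 hq).ne'
  have hpi : (Real.pi : ℂ) ≠ 0 := by exact_mod_cast Real.pi_ne_zero
  set r : ℂ := ((Real.sqrt q : ℝ) : ℂ) with hrdef
  have hlin : HasDerivAt (fun z : ℂ => Complex.I * κ * z - 1) (Complex.I * κ) r := by
    simpa using ((hasDerivAt_id r).const_mul (Complex.I * κ)).sub_const 1
  have he : HasDerivAt (fun z : ℂ => Complex.exp (Complex.I * κ * z))
      (Complex.exp (Complex.I * κ * r) * (Complex.I * κ)) r := by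
    simpa using ((hasDerivAt_id r).const_mul (Complex.I * κ)).cexp
  have hden : HasDerivAt (fun z : ℂ => 8 * Real.pi * z ^ 3) (8 * Real.pi * (3 * r ^ 2)) r := by
    simpa using (hasDerivAt_pow 3 r).const_mul (8 * Real.pi : ℂ)
  have h := hasDerivAt_comp_sqrt hq ((he.fun_mul hlin).fun_div hden (by simp [hpi, hr]))
  refine h.congr_deriv ?_
  rw [greenProfile'', ← hrdef]
  field_simp
  linear_combination (16 * κ ^ 2 * r ^ 2 : ℂ) * Complex.I_sq

lemma maxwellGreen_apply (κ : ℝ) {x y : R3} (h : x ≠ y) (l s : Fin 3) :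
    maxwellGreen κ x y l s
      = (if l = s then greenProfile κ (‖x - y‖ ^ 2)
          + 2 * ((κ : ℂ) ^ 2)⁻¹ * greenProfile' κ (‖x - y‖ ^ 2) else 0)
        + 4 * ((κ : ℂ) ^ 2)⁻¹ * greenProfile'' κ (‖x - y‖ ^ 2) * ((x - y) l * (x - y) s) := by
  have hfun : (fun z => helmholtzGreen κ z y) = fun z => (fun v : R3 => greenProfile κ (‖v‖ ^ 2))
      (z - y) := by
    funext z
    simp [helmholtzGreen, greenProfile, Real.sqrt_sq (norm_nonneg _)]
  have hq : 0 < ‖x - y‖ ^ 2 := by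
    have := norm_pos_iff.2 (sub_ne_zero.2 h); positivity
  rw [maxwellGreen, hfun, dyad_comp_sub κ (fun v : R3 => greenProfile κ (‖v‖ ^ 2)) y x, dyad_apply]
  have hh := hess_radial (y := x - y) (f := greenProfile κ) (f' := greenProfile' κ)
    (by filter_upwards [lt_mem_nhds hq] with q hq using hasDerivAt_greenProfile κ hq)
    (hasDerivAt_greenProfile' κ hq) l s
  simp only [hess, Matrix.of_apply] at hh
  rw [hh]
  split_ifs <;> ring

/-- The standing wave `j_0(κ|v|) = sin(κ|v|) / (κ|v|)` is, up to a factor, the difference of the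
outgoing and the incoming Green's functions; here after `I + κ⁻² ∇∇` has been applied. -/
lemma dyad_besselRadial_eq_sub {κ : ℝ} (hκ : 0 < κ) {x y : R3} (h : x ≠ y) (l s : Fin 3) :
    dyad κ (besselRadial κ 0) (y - x) l s
      = 2 * Real.pi / (Complex.I * κ) * (maxwellGreen κ x y l s - maxwellGreen (-κ) x y l s) := by
  have hk : (κ : ℂ) ≠ 0 := by exact_mod_cast hκ.ne'
  have hpi : (Real.pi : ℂ) ≠ 0 := by exact_mod_cast Real.pi_ne_zero
  have hq : 0 < ‖y - x‖ ^ 2 := by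
    have := norm_pos_iff.2 (sub_ne_zero.2 h.symm); positivity
  set c : ℂ := 2 * Real.pi / (Complex.I * κ) with hc
  have hfun : besselRadial κ 0 =ᶠ[nhds (y - x)]
      fun v : R3 => (fun q => c * (greenProfile κ q - greenProfile (-κ) q)) (‖v‖ ^ 2) := by
    filter_upwards [isOpen_ne.mem_nhds (sub_ne_zero.2 h.symm)] with v hv
    have hr : (‖v‖ : ℂ) ≠ 0 := by exact_mod_cast (norm_pos_iff.2 hv).ne'
    have hsin := besselEntire_zero_mul (κ * ‖v‖ : ℂ)
    rw [Complex.sin] at hsin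
    simp only [besselRadial, greenProfile, Real.sqrt_sq (norm_nonneg _)]
    push_cast
    rw [mul_pow] at hsin
    rw [show Complex.I * -κ * (‖v‖ : ℂ) = -(κ * ‖v‖) * Complex.I by ring,
      show Complex.I * κ * (‖v‖ : ℂ) = (κ * ‖v‖) * Complex.I by ring]
    have hkr : (κ * ‖v‖ : ℂ) ≠ 0 := mul_ne_zero hk hr
    apply mul_left_cancel₀ hkr
    rw [hsin, hc]
    field_simp
    linear_combination (4 * (Complex.exp (-(κ * ‖v‖ * Complex.I))
      - Complex.exp (κ * ‖v‖ * Complex.I))) * Complex.I_sq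
  rw [dyad_congr κ hfun, maxwellGreen_apply κ h, maxwellGreen_apply (-κ) h, dyad_apply]
  have hh := hess_radial (y := y - x) (f := fun q => c * (greenProfile κ q - greenProfile (-κ) q))
    (f' := fun q => c * (greenProfile' κ q - greenProfile' (-κ) q))
    (by
      filter_upwards [lt_mem_nhds hq] with q hq
      exact ((hasDerivAt_greenProfile κ hq).sub (hasDerivAt_greenProfile (-κ) hq)).const_mul c)
    (((hasDerivAt_greenProfile' κ hq).sub (hasDerivAt_greenProfile' (-κ) hq)).const_mul c) l s
  simp only [hess, Matrix.of_apply] at hh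
  rw [hh, norm_sub_rev y x]
  simp only [PiLp.sub_apply]
  push_cast
  split_ifs <;> ring

/-! ### The far-field expansion -/

/-- `|tθ - y|² / t²` as a polynomial in `s = 1/t`. -/
noncomputable def farSq (θ y : R3) (s : ℂ) : ℂ :=
  1 - 2 * s * (inner ℝ θ y : ℝ) + s ^ 2 * ((‖y‖ ^ 2 : ℝ) : ℂ)

/-- `|tθ - y| / t` as a function of `s = 1/t`, holomorphic where `|s| |y| < 1`. -/
noncomputable def farRoot (θ y : R3) (s : ℂ) : ℂ := farSq θ y s ^ (2⁻¹ : ℂ)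

lemma one_sub_mul_one_sub_mem_slitPlane {a b : ℂ} (ha : ‖a‖ < 1) (hb : ‖b‖ < 1) :
    (1 - a) * (1 - b) ∈ Complex.slitPlane := by
  have ha' : 0 < (1 - a).re := by
    have := Complex.re_le_norm a; simp only [Complex.sub_re, Complex.one_re]; linarith
  have hb' : 0 < (1 - b).re := by
    have := Complex.re_le_norm b; simp only [Complex.sub_re, Complex.one_re]; linarith
  generalize 1 - a = z at *
  generalize 1 - b = w at *
  rw [Complex.mem_slitPlane_iff]
  by_contra hcon
  push Not at hcon
  obtain ⟨h1, h2⟩ := hcon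
  simp only [Complex.mul_re, Complex.mul_im] at h1 h2
  have h3 : z.re * (z.re * w.re - z.im * w.im) = w.re * (z.re ^ 2 + z.im ^ 2) := by
    linear_combination (-z.im) * h2
  have h4 : 0 < w.re * (z.re ^ 2 + z.im ^ 2) := by positivity
  nlinarith

lemma farSq_mem_slitPlane {θ y : R3} (hθ : ‖θ‖ = 1) {s : ℂ} (hs : ‖s‖ * ‖y‖ < 1) :
    farSq θ y s ∈ Complex.slitPlane := by
  set c : ℝ := inner ℝ θ y
  have hc : c ^ 2 ≤ ‖y‖ ^ 2 := by
    have := abs_real_inner_le_norm θ y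
    rw [hθ, one_mul] at this
    exact sq_le_sq' (by linarith [neg_abs_le c]) ((le_abs_self c).trans this)
  set d : ℝ := Real.sqrt (‖y‖ ^ 2 - c ^ 2)
  have hd : d ^ 2 = ‖y‖ ^ 2 - c ^ 2 := Real.sq_sqrt (by linarith)
  have hn (e : ℝ) (he : e ^ 2 = ‖y‖ ^ 2 - c ^ 2) : ‖s * ((c : ℂ) + e * Complex.I)‖ < 1 := by
    have : ‖(c : ℂ) + e * Complex.I‖ = ‖y‖ := by
      rw [Complex.norm_add_mul_I, he, add_sub_cancel, Real.sqrt_sq (norm_nonneg _)]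
    rwa [norm_mul, this]
  have := one_sub_mul_one_sub_mem_slitPlane (hn d hd) (hn (-d) (by rw [neg_sq, hd]))
  convert this using 1
  have hd' := congrArg (fun x : ℝ => (x : ℂ)) hd
  simp only [farSq]
  push_cast at hd' ⊢
  linear_combination (-s ^ 2) * hd' + s ^ 2 * d ^ 2 * Complex.I_sq

lemma farRoot_sq (θ y : R3) (s : ℂ) : farRoot θ y s ^ 2 = farSq θ y s := by
  rw [farRoot]
  exact Complex.cpow_nat_inv_pow _ two_ne_zero

lemma farRoot_re_nonneg (θ y : R3) (s : ℂ) : 0 ≤ (farRoot θ y s).re := by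
  rw [farRoot, Complex.cpow_inv_two_re]
  exact Real.sqrt_nonneg _

lemma one_add_farRoot_ne_zero (θ y : R3) (s : ℂ) : 1 + farRoot θ y s ≠ 0 := by
  intro h
  have := farRoot_re_nonneg θ y s
  have h2 := congrArg Complex.re h
  simp at h2
  linarith

lemma farRoot_ne_zero {θ y : R3} (hθ : ‖θ‖ = 1) {s : ℂ} (hs : ‖s‖ * ‖y‖ < 1) :
    farRoot θ y s ≠ 0 := by
  intro h
  have := farRoot_sq θ y s
  rw [h] at this
  exact Complex.slitPlane_ne_zero (farSq_mem_slitPlane hθ hs) (by rw [← this]; norm_num)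

/-- The amplitude of the dyadic Green's tensor in the direction `θ`:
`G(tθ, y) = exp(iκt) / t * farKernel κ θ y (1/t)`. It is holomorphic in `s = 1/t` near `s = 0`. -/
noncomputable def farKernel (κ : ℝ) (θ y : R3) (s : ℂ) (l k : Fin 3) : ℂ :=
  Complex.exp (Complex.I * κ * ((-2 * (inner ℝ θ y : ℝ) + s * ((‖y‖ ^ 2 : ℝ) : ℂ))
      / (1 + farRoot θ y s))) / (4 * Real.pi)
    * ((if l = k then 1 else 0) * (1 / farRoot θ y s
          + ((κ : ℂ) ^ 2)⁻¹ * (Complex.I * κ * farRoot θ y s * s - s ^ 2) / farRoot θ y s ^ 3)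
      + ((κ : ℂ) ^ 2)⁻¹ * ((θ l - s * y l) * (θ k - s * y k))
        * (-κ ^ 2 * farRoot θ y s ^ 2 - 3 * Complex.I * κ * farRoot θ y s * s + 3 * s ^ 2)
        / farRoot θ y s ^ 5)

lemma farKernel_neg (κ : ℝ) (θ y : R3) (s : ℂ) (l k : Fin 3) :
    farKernel (-κ) θ y s l k = farKernel κ (-θ) y (-s) l k := by
  have h1 : farRoot (-θ) y (-s) = farRoot θ y s := by
    simp [farRoot, farSq, inner_neg_left]
  simp only [farKernel, h1, inner_neg_left, PiLp.neg_apply]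
  push_cast
  rw [show Complex.I * -(κ : ℂ) * ((-2 * (inner ℝ θ y : ℝ) + s * (‖y‖ : ℂ) ^ 2)
      / (1 + farRoot θ y s)) = Complex.I * κ * ((-2 * -((inner ℝ θ y : ℝ) : ℂ) + -s * (‖y‖ : ℂ) ^ 2)
      / (1 + farRoot θ y s)) by ring]
  ring

lemma maxwellGreen_eq_farKernel (κ : ℝ) {θ y : R3} (hθ : ‖θ‖ = 1) {t : ℝ} (ht : ‖y‖ < t)
    (l k : Fin 3) :
    maxwellGreen κ (t • θ) y l k
      = Complex.exp (Complex.I * κ * t) / t * farKernel κ θ y ((t : ℂ)⁻¹) l k := by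
  have ht0 : 0 < t := (norm_nonneg y).trans_lt ht
  have htc : (t : ℂ) ≠ 0 := by exact_mod_cast ht0.ne'
  have hne : t • θ ≠ y := by
    rintro rfl
    rw [norm_smul, hθ, mul_one, Real.norm_of_nonneg ht0.le] at ht
    exact lt_irrefl _ ht
  have hr0 : 0 < ‖t • θ - y‖ := norm_pos_iff.2 (sub_ne_zero.2 hne)
  have hpi : (Real.pi : ℂ) ≠ 0 := by exact_mod_cast Real.pi_ne_zero
  have hrsq : ‖t • θ - y‖ ^ 2 = t ^ 2 - 2 * t * inner ℝ θ y + ‖y‖ ^ 2 := by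
    rw [norm_sub_sq_real, norm_smul, hθ, real_inner_smul_left, Real.norm_of_nonneg ht0.le]; ring
  set r : ℝ := ‖t • θ - y‖ with hr
  have hrsq' := congrArg (fun x : ℝ => (x : ℂ)) hrsq
  push_cast at hrsq'
  have hrc : (r : ℂ) ≠ 0 := by exact_mod_cast hr0.ne'
  -- the root is the one with nonnegative real part
  have hw : farRoot θ y ((t : ℂ)⁻¹) = r / t := by
    have h1 : farRoot θ y ((t : ℂ)⁻¹) ^ 2 = (r / t : ℂ) ^ 2 := by
      rw [farRoot_sq, farSq, div_pow, hrsq']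
      field_simp
      push_cast; ring
    rcases sq_eq_sq_iff_eq_or_eq_neg.1 h1 with h | h
    · exact h
    · exfalso
      have h2 := farRoot_re_nonneg θ y ((t : ℂ)⁻¹)
      rw [h, ← Complex.ofReal_div, ← Complex.ofReal_neg, Complex.ofReal_re] at h2
      have : 0 < r / t := by positivity
      linarith
  have h1w : (t + r : ℂ) ≠ 0 := by exact_mod_cast (add_pos ht0 hr0).ne'
  have hphase : Complex.exp (Complex.I * κ * r) = Complex.exp (Complex.I * κ * t)
      * Complex.exp (Complex.I * κ * ((-2 * (inner ℝ θ y : ℝ) + (t : ℂ)⁻¹ * ((‖y‖ ^ 2 : ℝ) : ℂ))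
      / (1 + r / t))) := by
    rw [← Complex.exp_add]
    congr 1
    have h1w' : (1 + r / t : ℂ) ≠ 0 := by
      rw [← hw]; exact one_add_farRoot_ne_zero _ _ _
    push_cast
    field_simp
    linear_combination (κ : ℂ) * hrsq'
  rw [maxwellGreen_apply κ hne, ← hr, farKernel, hw]
  simp only [greenProfile, greenProfile', greenProfile'', Real.sqrt_sq hr0.le]
  rw [hphase]
  set e1 := Complex.exp (Complex.I * κ * t)
  set e2 := Complex.exp (Complex.I * κ * ((-2 * (inner ℝ θ y : ℝ) + (t : ℂ)⁻¹ * ((‖y‖ ^ 2 : ℝ) : ℂ))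
      / (1 + r / t)))
  simp only [PiLp.sub_apply, PiLp.smul_apply, smul_eq_mul]
  push_cast
  generalize ((κ : ℂ) ^ 2)⁻¹ = K
  split_ifs
  · field_simp
    ring
  · field_simp
    ring

lemma mul_lt_one_of_mem_ball {R : ℝ} (hR : 0 < R) {s : ℂ} {y : R3} (hs : s ∈ ball (0 : ℂ) R⁻¹)
    (hy : y ∈ closedBall (0 : R3) R) : ‖s‖ * ‖y‖ < 1 := by
  rw [mem_ball_zero_iff] at hs
  rw [mem_closedBall_zero_iff] at hy
  calc ‖s‖ * ‖y‖ ≤ ‖s‖ * R := by gcongr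
    _ < R⁻¹ * R := by gcongr
    _ = 1 := inv_mul_cancel₀ hR.ne'

lemma continuousOn_farRoot {R : ℝ} (hR : 0 < R) {θ : R3} (hθ : ‖θ‖ = 1) :
    ContinuousOn (fun p : ℂ × R3 => farRoot θ p.2 p.1) (ball 0 R⁻¹ ×ˢ closedBall 0 R) := by
  refine ContinuousOn.cpow_const (Continuous.continuousOn ?_) ?_
  · simp only [farSq]; fun_prop
  · rintro ⟨s, y⟩ ⟨hs, hy⟩
    exact farSq_mem_slitPlane hθ (mul_lt_one_of_mem_ball hR hs hy)

lemma differentiableOn_farRoot {R : ℝ} (hR : 0 < R) {θ : R3} (hθ : ‖θ‖ = 1) {y : R3}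
    (hy : y ∈ closedBall (0 : R3) R) :
    DifferentiableOn ℂ (fun s => farRoot θ y s) (ball 0 R⁻¹) := by
  refine DifferentiableOn.cpow_const (Differentiable.differentiableOn ?_) ?_
  · unfold farSq; fun_prop
  · exact fun s hs => farSq_mem_slitPlane hθ (mul_lt_one_of_mem_ball hR hs hy)

lemma continuousOn_farKernel (κ : ℝ) {R : ℝ} (hR : 0 < R) {θ : R3} (hθ : ‖θ‖ = 1) (l k : Fin 3) :
    ContinuousOn (fun p : ℂ × R3 => farKernel κ θ p.2 p.1 l k)
      (ball 0 R⁻¹ ×ˢ closedBall 0 R) := by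
  have hw := continuousOn_farRoot hR hθ
  have hw0 : ∀ p ∈ ball (0 : ℂ) R⁻¹ ×ˢ closedBall (0 : R3) R, farRoot θ p.2 p.1 ≠ 0 := by
    rintro ⟨s, y⟩ ⟨hs, hy⟩
    exact farRoot_ne_zero hθ (mul_lt_one_of_mem_ball hR hs hy)
  have hphase : ContinuousOn (fun p : ℂ × R3 =>
      (-2 * (inner ℝ θ p.2 : ℝ) + p.1 * ((‖p.2‖ ^ 2 : ℝ) : ℂ)) / (1 + farRoot θ p.2 p.1))
      (ball 0 R⁻¹ ×ˢ closedBall 0 R) :=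
    ContinuousOn.div (Continuous.continuousOn (by fun_prop)) (continuousOn_const.add hw)
      fun p _ => one_add_farRoot_ne_zero _ _ _
  have hs : ContinuousOn (fun p : ℂ × R3 => p.1) (ball 0 R⁻¹ ×ˢ closedBall (0 : R3) R) :=
    continuousOn_fst
  have hvv : ContinuousOn (fun p : ℂ × R3 => ((θ l : ℂ) - p.1 * p.2 l) * (θ k - p.1 * p.2 k))
      (ball 0 R⁻¹ ×ˢ closedBall (0 : R3) R) := Continuous.continuousOn (by fun_prop)
  simp only [farKernel]
  refine ContinuousOn.mul ((continuousOn_const.mul hphase).cexp.div_const _) (ContinuousOn.add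
    (continuousOn_const.mul (ContinuousOn.add (continuousOn_const.div hw hw0)
      (ContinuousOn.div ?_ (hw.pow 3) fun p hp => pow_ne_zero _ (hw0 p hp))))
    (ContinuousOn.div ?_ (hw.pow 5) fun p hp => pow_ne_zero _ (hw0 p hp)))
  · exact continuousOn_const.mul (((continuousOn_const.mul hw).mul hs).sub (hs.pow 2))
  · exact (continuousOn_const.mul hvv).mul (((continuousOn_const.mul (hw.pow 2)).sub
      ((continuousOn_const.mul hw).mul hs)).add (continuousOn_const.mul (hs.pow 2)))

lemma differentiableOn_farKernel (κ : ℝ) {R : ℝ} (hR : 0 < R) {θ : R3} (hθ : ‖θ‖ = 1) {y : R3}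
    (hy : y ∈ closedBall (0 : R3) R) (l k : Fin 3) :
    DifferentiableOn ℂ (fun s => farKernel κ θ y s l k) (ball 0 R⁻¹) := by
  have hw := differentiableOn_farRoot hR hθ hy
  have hw0 : ∀ s ∈ ball (0 : ℂ) R⁻¹, farRoot θ y s ≠ 0 := fun s hs =>
    farRoot_ne_zero hθ (mul_lt_one_of_mem_ball hR hs hy)
  have hphase : DifferentiableOn ℂ (fun s : ℂ =>
      (-2 * (inner ℝ θ y : ℝ) + s * ((‖y‖ ^ 2 : ℝ) : ℂ)) / (1 + farRoot θ y s)) (ball 0 R⁻¹) :=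
    DifferentiableOn.fun_div (Differentiable.differentiableOn (by fun_prop))
      ((differentiableOn_const _).fun_add hw) fun p _ => one_add_farRoot_ne_zero _ _ _
  have hs : DifferentiableOn ℂ (fun s : ℂ => s) (ball 0 R⁻¹) := differentiableOn_id
  have hvv : DifferentiableOn ℂ (fun s : ℂ => ((θ l : ℂ) - s * y l) * (θ k - s * y k))
      (ball 0 R⁻¹) := Differentiable.differentiableOn (by fun_prop)
  simp only [farKernel]
  refine DifferentiableOn.fun_mul ((hphase.const_mul _).cexp.div_const _) (DifferentiableOn.fun_add
    (DifferentiableOn.const_mul (DifferentiableOn.fun_add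
      ((differentiableOn_const _).fun_div hw hw0)
      (DifferentiableOn.fun_div ?_ (hw.fun_pow 3) fun p hp => pow_ne_zero _ (hw0 p hp))) _)
    (DifferentiableOn.fun_div ?_ (hw.fun_pow 5) fun p hp => pow_ne_zero _ (hw0 p hp)))
  · exact (((hw.const_mul _).fun_mul hs).fun_sub (hs.fun_pow 2)).const_mul _
  · exact (hvv.const_mul _).fun_mul ((((hw.fun_pow 2).const_mul _).fun_sub
      ((hw.const_mul _).fun_mul hs)).fun_add ((hs.fun_pow 2).const_mul _))

/-- The amplitude of the field radiated by `J` in the direction `θ`, as a holomorphic function of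
`s = 1/|x|`. Its value at `s = 0` is the far-field pattern. -/
noncomputable def farAmplitude (κ R : ℝ) (J : R3 → C3) (θ : R3) (l : Fin 3) (s : ℂ) : ℂ :=
  ∑ k, ∫ y in ball (0 : R3) R, farKernel κ θ y s l k * J y k

lemma farAmplitude_neg (κ R : ℝ) (J : R3 → C3) (θ : R3) (l : Fin 3) (s : ℂ) :
    farAmplitude (-κ) R J θ l s = farAmplitude κ R J (-θ) l (-s) := by
  simp only [farAmplitude, farKernel_neg]

lemma differentiableOn_farAmplitude (κ : ℝ) {R : ℝ} (hR : 0 < R) {J : R3 → C3}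
    (hJ : IntegrableOn J (ball 0 R)) {θ : R3} (hθ : ‖θ‖ = 1) (l : Fin 3) :
    DifferentiableOn ℂ (farAmplitude κ R J θ l) (ball 0 R⁻¹) := by
  refine DifferentiableOn.fun_sum fun k _ => ?_
  exact differentiableOn_setIntegral_mul isOpen_ball (continuousOn_farKernel κ hR hθ l k)
    (fun y hy => differentiableOn_farKernel κ hR hθ (ball_subset_closedBall hy) l k)
    (integrableOn_coord hJ k)

lemma inv_mem_ball {R t : ℝ} (hR : 0 < R) (ht : R < t) : ((t : ℂ)⁻¹) ∈ ball (0 : ℂ) R⁻¹ := by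
  rw [mem_ball_zero_iff, norm_inv, Complex.norm_real, Real.norm_of_nonneg (hR.trans ht).le]
  exact (inv_lt_inv₀ (hR.trans ht) hR).2 ht

lemma continuousOn_maxwellGreen (κ : ℝ) {R : ℝ} (hR : 0 < R) {x : R3} (hx : R < ‖x‖)
    (l k : Fin 3) : ContinuousOn (fun y => maxwellGreen κ x y l k) (closedBall 0 R) := by
  have hx0 : 0 < ‖x‖ := hR.trans hx
  have hθ : ‖(‖x‖⁻¹ • x)‖ = 1 := by
    rw [norm_smul, norm_inv, norm_norm, inv_mul_cancel₀ hx0.ne']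
  have hx' : x = ‖x‖ • (‖x‖⁻¹ • x) := by rw [smul_inv_smul₀ hx0.ne']
  have hc : ContinuousOn (fun y : R3 => ((‖x‖ : ℂ)⁻¹, y)) (closedBall 0 R) :=
    (Continuous.prodMk_right _).continuousOn
  have h := (continuousOn_farKernel κ hR hθ l k).comp hc
    fun y hy => ⟨inv_mem_ball hR hx, hy⟩
  refine ((continuousOn_const (c := Complex.exp (Complex.I * κ * (‖x‖ : ℝ)) / (‖x‖ : ℝ))).mul
    h).congr fun y hy => ?_
  conv_lhs => rw [hx']
  exact maxwellGreen_eq_farKernel κ hθ ((mem_closedBall_zero_iff.1 hy).trans_lt hx) l k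

lemma electricField_coord (κ : ℝ) {R : ℝ} (hR : 0 < R) {J : R3 → C3}
    (hJ : IntegrableOn J (ball 0 R)) {x : R3} (hx : R < ‖x‖) (l : Fin 3) :
    electricField κ R J x l = ∑ k, ∫ y in ball (0 : R3) R, maxwellGreen κ x y l k * J y k :=
  integral_apply_coord (fun l k => continuousOn_maxwellGreen κ hR hx l k) hJ l

lemma electricField_eq_farAmplitude (κ : ℝ) {R : ℝ} (hR : 0 < R) {J : R3 → C3}
    (hJ : IntegrableOn J (ball 0 R)) {θ : R3} (hθ : ‖θ‖ = 1) {t : ℝ} (ht : R < t) (l : Fin 3) :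
    electricField κ R J (t • θ) l
      = Complex.exp (Complex.I * κ * t) / t * farAmplitude κ R J θ l ((t : ℂ)⁻¹) := by
  have htn : R < ‖t • θ‖ := by
    rwa [norm_smul, hθ, mul_one, Real.norm_of_nonneg (hR.trans ht).le]
  rw [electricField_coord κ hR hJ htn, farAmplitude, Finset.mul_sum]
  refine Finset.sum_congr rfl fun k _ => ?_
  rw [← integral_const_mul]
  refine setIntegral_congr_fun measurableSet_ball fun y hy => ?_
  have hy' : ‖y‖ < t := (mem_ball_zero_iff.1 hy).trans ht
  simp only [maxwellGreen_eq_farKernel κ hθ hy']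
  ring

/-- Outside the ball the moments against the translates of the standing wave are, up to a factor,
the difference of the outgoing and the incoming field. -/
lemma shiftMoment_eq_sub {κ : ℝ} (hκ : 0 < κ) {R : ℝ} (hR : 0 < R) {J : R3 → C3}
    (hJ : IntegrableOn J (ball 0 R)) {x : R3} (hx : R < ‖x‖) :
    shiftMoment κ R J (besselRadial κ 0) x = (2 * Real.pi / (Complex.I * κ) : ℂ)
      • (electricField κ R J x - electricField (-κ) R J x) := by
  ext l
  have hint (κ : ℝ) (k : Fin 3) := integrableOn_mul_of_continuousOn
    (continuousOn_maxwellGreen κ hR hx l k) (integrableOn_coord hJ k)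
  rw [shiftMoment_coord hJ (contDiff_besselRadial κ 0), PiLp.smul_apply, PiLp.sub_apply,
    electricField_coord κ hR hJ hx, electricField_coord (-κ) hR hJ hx, ← Finset.sum_sub_distrib,
    Finset.smul_sum]
  refine Finset.sum_congr rfl fun k _ => ?_
  rw [← integral_sub (hint κ k) (hint (-κ) k), ← integral_smul]
  refine setIntegral_congr_fun measurableSet_ball fun y hy => ?_
  have hne : x ≠ y := by
    rintro rfl
    exact lt_irrefl _ ((mem_ball_zero_iff.1 hy).trans hx)
  simp only [dyad_besselRadial_eq_sub hκ hne, smul_eq_mul]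
  ring

/-- An essential singularity cannot be cancelled: if `exp(ic/s) Φ(s) = Ψ(s)` for small `s > 0`, with
`Φ` and `Ψ` holomorphic near `0`, then `Φ = 0`. Indeed the relation persists as `s → 0` along the
negative imaginary axis, where `exp(ic/s)` decays faster than any power of `s`. -/
lemma eqOn_zero_of_exp_mul_eq {ρ c : ℝ} (hρ : 0 < ρ) (hc : 0 < c) {Φ Ψ : ℂ → ℂ}
    (hΦ : DifferentiableOn ℂ Φ (ball 0 ρ)) (hΨ : DifferentiableOn ℂ Ψ (ball 0 ρ))
    (h : ∀ t : ℝ, ρ⁻¹ < t → Complex.exp (Complex.I * c * t) * Φ ((t : ℂ)⁻¹) = Ψ ((t : ℂ)⁻¹)) :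
    Set.EqOn Φ 0 (ball 0 ρ) := by
  have hreal : ∀ s : ℝ, 0 < s → s < ρ → Complex.exp (Complex.I * c * (s : ℂ)⁻¹) * Φ s = Ψ s := by
    intro s hs hsρ
    have := h s⁻¹ ((inv_lt_inv₀ hρ hs).2 hsρ)
    simpa using this
  -- the relation on the part of the disc to the right of the line `re s = im s`
  have hV : ∀ s ∈ ball (0 : ℂ) ρ, 0 < s.re - s.im →
      Complex.exp (Complex.I * c * s⁻¹) * Φ s = Ψ s := by
    set V : Set ℂ := ball 0 ρ ∩ {s | 0 < s.re - s.im} with hVdef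
    have hVo : IsOpen V := isOpen_ball.inter
      (isOpen_lt continuous_const (Complex.continuous_re.sub Complex.continuous_im))
    have hVc : Convex ℝ V := by
      refine (convex_ball _ _).inter ?_
      exact convex_halfSpace_gt (𝕜 := ℝ) (f := fun s : ℂ => s.re - s.im)
        ((Complex.reLm - Complex.imLm).isLinear) 0
    have hne : ∀ s ∈ V, s ≠ 0 := by
      rintro s hs rfl
      simpa using hs.2
    have hdiff : DifferentiableOn ℂ
        (fun s => Complex.exp (Complex.I * c * s⁻¹) * Φ s - Ψ s) V := by
      refine DifferentiableOn.fun_sub (DifferentiableOn.fun_mul ?_ (hΦ.mono Set.inter_subset_left))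
        (hΨ.mono Set.inter_subset_left)
      exact ((differentiableOn_id.fun_inv hne).const_mul _).cexp
    have hmem : ((ρ / 2 : ℝ) : ℂ) ∈ V := by
      refine ⟨?_, ?_⟩
      · rw [mem_ball_zero_iff, Complex.norm_real, Real.norm_of_nonneg (by positivity)]
        linarith
      · change 0 < (((ρ / 2 : ℝ) : ℂ)).re - (((ρ / 2 : ℝ) : ℂ)).im
        rw [Complex.ofReal_re, Complex.ofReal_im]; linarith
    have := eqOn_zero_of_eventually_ofReal hVo hVc.isPreconnected hdiff hmem (by
      filter_upwards [lt_mem_nhds (show 0 < ρ / 2 by positivity),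
        gt_mem_nhds (show ρ / 2 < ρ by linarith)] with s h1 h2
      rw [hreal s h1 h2, sub_self])
    intro s hs hs'
    exact sub_eq_zero.1 (this ⟨hs, hs'⟩)
  have hΨ0 : AnalyticAt ℂ Ψ 0 := hΨ.analyticAt (isOpen_ball.mem_nhds (mem_ball_self hρ))
  have hΨz : ∀ᶠ s in nhds (0 : ℂ), Ψ s = 0 := by
    by_contra hcon
    obtain ⟨n, g, hg, hg0, hgΨ⟩ := hΨ0.exists_eventuallyEq_pow_smul_nonzero_iff.2 hcon
    apply hg0
    have hseq : Filter.Tendsto (fun τ : ℝ => (Complex.I * (τ : ℂ))⁻¹) Filter.atTop (nhds 0) := by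
      refine squeeze_zero_norm' (a := fun τ : ℝ => τ⁻¹) ?_ tendsto_inv_atTop_zero
      filter_upwards [Filter.eventually_gt_atTop 0] with τ hτ
      simp [abs_of_pos hτ]
    have hgt : Filter.Tendsto (fun τ : ℝ => g (Complex.I * (τ : ℂ))⁻¹) Filter.atTop
        (nhds (g 0)) := hg.continuousAt.tendsto.comp hseq
    refine tendsto_nhds_unique hgt ?_
    have hΦc : ContinuousAt Φ 0 :=
      (hΦ.differentiableAt (isOpen_ball.mem_nhds (mem_ball_self hρ))).continuousAt
    have hΦb : ∀ᶠ τ : ℝ in Filter.atTop, ‖Φ (Complex.I * (τ : ℂ))⁻¹‖ < ‖Φ 0‖ + 1 :=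
      (hΦc.norm.tendsto.comp hseq).eventually (gt_mem_nhds (lt_add_one _))
    have hdecay : Filter.Tendsto (fun τ : ℝ => (‖Φ 0‖ + 1) * (τ ^ (n : ℝ) * Real.exp (-c * τ)))
        Filter.atTop (nhds 0) := by
      have := (tendsto_rpow_mul_exp_neg_mul_atTop_nhds_zero n c hc).const_mul (‖Φ 0‖ + 1)
      simpa using this
    refine squeeze_zero_norm' ?_ hdecay
    filter_upwards [hΦb, hseq.eventually hgΨ, Filter.eventually_gt_atTop 0,
      hseq.eventually (isOpen_ball.mem_nhds (mem_ball_self hρ))] with τ h1 h2 hτ h3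
    set s : ℂ := (Complex.I * (τ : ℂ))⁻¹ with hs
    have hτc : (τ : ℂ) ≠ 0 := by exact_mod_cast hτ.ne'
    have hs1 : s = ((-τ⁻¹ : ℝ) : ℂ) * Complex.I := by
      rw [hs, mul_inv, Complex.inv_I]; push_cast; ring
    have hV' := hV s h3 (by
      rw [hs1]
      simp only [Complex.re_ofReal_mul, Complex.im_ofReal_mul, Complex.I_re, Complex.I_im]
      have := inv_pos.2 hτ
      linarith)
    have hsi : s⁻¹ = Complex.I * τ := by rw [hs, inv_inv]
    have he : Complex.exp (Complex.I * c * s⁻¹) = ((Real.exp (-c * τ) : ℝ) : ℂ) := by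
      rw [hsi]
      push_cast
      congr 1
      linear_combination (c * τ : ℂ) * Complex.I_sq
    have hgn : ‖g s‖ = τ ^ n * ‖Ψ s‖ := by
      rw [h2, sub_zero, norm_smul, norm_pow, hs1, norm_mul, Complex.norm_I, mul_one,
        Complex.norm_real, norm_neg, norm_inv, Real.norm_of_nonneg hτ.le, ← mul_assoc, ← mul_pow,
        mul_inv_cancel₀ hτ.ne', one_pow, one_mul]
    rw [hgn, ← hV', he, norm_mul, Complex.norm_real, Real.norm_of_nonneg (Real.exp_pos _).le,
      Real.rpow_natCast]
    have hE := Real.exp_pos (-c * τ)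
    have hP : 0 < τ ^ n := by positivity
    calc τ ^ n * (Real.exp (-c * τ) * ‖Φ s‖) ≤ τ ^ n * (Real.exp (-c * τ) * (‖Φ 0‖ + 1)) := by
          gcongr
      _ = _ := by ring
  have hΨzero : Set.EqOn Ψ 0 (ball 0 ρ) :=
    (hΨ.analyticOnNhd isOpen_ball).eqOn_zero_of_preconnected_of_eventuallyEq_zero
      (convex_ball _ _).isPreconnected (mem_ball_self hρ) hΨz
  refine eqOn_zero_of_eventually_ofReal (t₀ := ρ / 2) isOpen_ball (convex_ball _ _).isPreconnected
    hΦ ?_ ?_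
  · rw [mem_ball_zero_iff, Complex.norm_real, Real.norm_of_nonneg (by positivity)]
    linarith
  · filter_upwards [lt_mem_nhds (show 0 < ρ / 2 by positivity),
      gt_mem_nhds (show ρ / 2 < ρ by linarith)] with s h1 h2
    have h3 := hreal s h1 h2
    have h4 : (s : ℂ) ∈ ball (0 : ℂ) ρ := by
      rwa [mem_ball_zero_iff, Complex.norm_real, Real.norm_of_nonneg h1.le]
    rw [hΨzero h4] at h3
    exact (mul_eq_zero.1 h3).resolve_left (Complex.exp_ne_zero _)

/-! ### Nonradiating currents -/

lemma electricField_eq_zero_of_farAmplitude (κ : ℝ) {R : ℝ} (hR : 0 < R) {J : R3 → C3}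
    (hJ : IntegrableOn J (ball 0 R))
    (h : ∀ θ : R3, ‖θ‖ = 1 → ∀ l, ∀ s ∈ ball (0 : ℂ) R⁻¹, farAmplitude κ R J θ l s = 0)
    {x : R3} (hx : R < ‖x‖) : electricField κ R J x = 0 := by
  have hx0 : 0 < ‖x‖ := hR.trans hx
  have hθ : ‖(‖x‖⁻¹ • x)‖ = 1 := by
    rw [norm_smul, norm_inv, norm_norm, inv_mul_cancel₀ hx0.ne']
  ext l
  have := electricField_eq_farAmplitude κ hR hJ hθ hx l
  rw [smul_inv_smul₀ hx0.ne', h _ hθ l _ (inv_mem_ball hR hx), mul_zero] at this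
  rw [this]; rfl

/-- Forward, the outgoing amplitudes vanish, hence so do the incoming ones, which are the same
functions at `(-θ, -s)`; backward, the outgoing and the incoming field agree outside the ball, which
their different behaviour at infinity forbids unless they vanish. -/
lemma nonradiating_iff_shiftMoment {κ R : ℝ} (hκ : 0 < κ) (hR : 0 < R) {J : R3 → C3}
    (hJ : IntegrableOn J (ball 0 R)) :
    Nonradiating κ R J ↔ ∀ a : R3, R < ‖a‖ → shiftMoment κ R J (besselRadial κ 0) a = 0 := by
  have hk : (κ : ℂ) ≠ 0 := by exact_mod_cast hκ.ne'
  have hnorm {θ : R3} (hθ : ‖θ‖ = 1) {t : ℝ} (ht : R < t) : R < ‖t • θ‖ := by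
    rwa [norm_smul, hθ, mul_one, Real.norm_of_nonneg (hR.trans ht).le]
  constructor
  · intro h a ha
    have hamp : ∀ θ : R3, ‖θ‖ = 1 → ∀ l, Set.EqOn (farAmplitude κ R J θ l) 0 (ball 0 R⁻¹) := by
      intro θ hθ l
      have hR1 : 0 < (R + 1)⁻¹ := by positivity
      refine eqOn_zero_of_eventually_ofReal (t₀ := (R + 1)⁻¹) isOpen_ball
        (convex_ball _ _).isPreconnected (differentiableOn_farAmplitude κ hR hJ hθ l) ?_ ?_
      · have := inv_mem_ball hR (lt_add_one R)
        rwa [← Complex.ofReal_inv] at this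
      · filter_upwards [lt_mem_nhds hR1,
          gt_mem_nhds ((inv_lt_inv₀ (by positivity) hR).2 (lt_add_one R))] with s h1 h2
        have hs : R < s⁻¹ := by rwa [lt_inv_comm₀ hR h1]
        have hE := electricField_eq_farAmplitude κ hR hJ hθ hs l
        have hs0 : ((s⁻¹ : ℝ) : ℂ) ≠ 0 := by exact_mod_cast (inv_pos.2 h1).ne'
        rw [h _ (hnorm hθ hs)] at hE
        have := (mul_eq_zero.1 hE.symm).resolve_left (div_ne_zero (Complex.exp_ne_zero _) hs0)
        simpa using this
    have hin : electricField (-κ) R J a = 0 := by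
      refine electricField_eq_zero_of_farAmplitude (-κ) hR hJ (fun θ hθ l s hs => ?_) ha
      rw [farAmplitude_neg]
      exact hamp (-θ) (by rwa [norm_neg]) l
        (by rwa [mem_ball_zero_iff, norm_neg, ← mem_ball_zero_iff])
    rw [shiftMoment_eq_sub hκ hR hJ ha, h a ha, hin, sub_zero, smul_zero]
  · intro h x hx
    refine electricField_eq_zero_of_farAmplitude κ hR hJ (fun θ hθ l => ?_) hx
    refine eqOn_zero_of_exp_mul_eq (c := 2 * κ) (inv_pos.2 hR) (by positivity)
      (differentiableOn_farAmplitude κ hR hJ hθ l)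
      (differentiableOn_farAmplitude (-κ) hR hJ hθ l) fun t ht => ?_
    rw [inv_inv] at ht
    have htc : (t : ℂ) ≠ 0 := by exact_mod_cast (hR.trans ht).ne'
    have hc : (2 * Real.pi / (Complex.I * κ) : ℂ) ≠ 0 := by
      have hpi : (Real.pi : ℂ) ≠ 0 := by exact_mod_cast Real.pi_ne_zero
      exact div_ne_zero (mul_ne_zero two_ne_zero hpi) (mul_ne_zero Complex.I_ne_zero hk)
    have h1 := shiftMoment_eq_sub hκ hR hJ (hnorm hθ ht)
    rw [h _ (hnorm hθ ht)] at h1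
    have h2 := congrArg (fun v : C3 => v l)
      (sub_eq_zero.1 ((smul_eq_zero.1 h1.symm).resolve_left hc))
    simp only [electricField_eq_farAmplitude κ hR hJ hθ ht,
      electricField_eq_farAmplitude (-κ) hR hJ hθ ht] at h2
    have he : Complex.exp (Complex.I * ((2 * κ : ℝ) : ℂ) * t)
        = Complex.exp (Complex.I * κ * t) * Complex.exp (Complex.I * κ * t) := by
      rw [← Complex.exp_add]; congr 1; push_cast; ring
    have he' : Complex.exp (Complex.I * κ * t) * Complex.exp (Complex.I * ((-κ : ℝ) : ℂ) * t) = 1 := by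
      rw [← Complex.exp_add, ← Complex.exp_zero]; congr 1; push_cast; ring
    rw [div_mul_eq_mul_div, div_mul_eq_mul_div, div_left_inj' htc] at h2
    rw [he]
    push_cast at h2 he' ⊢
    linear_combination Complex.exp (Complex.I * κ * t) * h2
      + farAmplitude (-κ) R J θ l (t : ℂ)⁻¹ * he'

lemma contDiff_wave {κ : ℝ} (hκ : 0 < κ) {n : ℕ} {m : ℤ} (h1 : -(n : ℤ) ≤ m) (h2 : m ≤ n) :
    ContDiff ℝ ∞ (wave κ n m) := by
  obtain ⟨c, -, hc⟩ := exists_wave_eq hκ m.natAbs (n - m.natAbs) m (by omega)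
  rw [show m.natAbs + (n - m.natAbs) = n by omega] at hc
  rw [funext hc]
  exact contDiff_const.mul (contDiff_cwave κ _ _ _)

/-- A current is nonradiating if and only if its moments against all the waves vanish. -/
lemma nonradiating_iff_betaCoeff {κ R : ℝ} (hκ : 0 < κ) (hR : 0 < R) {J : R3 → C3}
    (hJ : IntegrableOn J (ball 0 R)) :
    Nonradiating κ R J ↔ ∀ (n : ℕ) (m : ℤ), -(n : ℤ) ≤ m → m ≤ n → betaCoeff κ R J n m = 0 := by
  rw [nonradiating_iff_shiftMoment hκ hR hJ]
  constructor
  · intro h n m h1 h2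
    obtain ⟨c, -, hc⟩ := exists_wave_eq hκ m.natAbs (n - m.natAbs) m (by omega)
    rw [show m.natAbs + (n - m.natAbs) = n by omega] at hc
    have hε : (if m = m.natAbs then -Complex.I else Complex.I) ^ 2 = -1 := by
      split_ifs <;> simp
    have hz := moment_cwave_eq_zero_of_shiftMoment hκ hJ
      (shiftMoment_eq_zero_of_forall_norm_gt hκ hR hJ h) hε m.natAbs (n - m.natAbs)
    change moment κ R J (wave κ n m) = 0
    rw [funext hc]
    exact (moment_smul c _).trans (by rw [hz, smul_zero])
  · intro h a _
    refine shiftMoment_eq_zero_of_moment_cwave hκ hJ (fun ε hε m d => ?_) a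
    have key (k : ℤ) (hk : k = m ∨ k = -m) :
        moment κ R J (cwave κ (if k = m then -Complex.I else Complex.I) m d) = 0 := by
      obtain ⟨c, hc0, hc⟩ := exists_wave_eq hκ m d k hk
      have hb : moment κ R J (wave κ (m + d) k) = 0 :=
        h (m + d) k (by push_cast; omega) (by push_cast; omega)
      rw [funext hc] at hb
      have := (moment_smul c _).symm.trans hb
      exact (smul_eq_zero.1 this).resolve_left hc0
    have h0 := key m (Or.inl rfl)
    rw [if_pos rfl] at h0
    rcases sq_eq_sq_iff_eq_or_eq_neg.1 (hε.trans Complex.I_sq.symm) with rfl | rfl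
    · rcases Nat.eq_zero_or_pos m with rfl | hm
      · -- for `m = 0` the wave does not depend on `ε`
        have : cwave κ Complex.I 0 d = cwave κ (-Complex.I) 0 d := by funext y; simp [cwave]
        rw [this, h0]
      · have h1 := key (-m) (Or.inr rfl)
        rwa [if_neg (by omega)] at h1
    · exact h0

lemma apply_smul_one (c : ℂ) (v : C3) : apply (c • (1 : Matrix (Fin 3) (Fin 3) ℂ)) v = c • v := by
  ext i
  simp [apply, Matrix.smul_mulVec]

lemma contDiff_hess {φ : R3 → ℂ} (hφ : ContDiff ℝ ∞ φ) (l s : Fin 3) :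
    ContDiff ℝ ∞ (fun y => hess φ y l s) :=
  ContDiff.partialDeriv (ContDiff.partialDeriv hφ s) l

lemma betaCoeff_eq_alphaCoeff_add_gammaCoeff {κ R : ℝ} (hκ : 0 < κ) {J : R3 → C3}
    (hJ : IntegrableOn J (ball 0 R)) {n : ℕ} {m : ℤ} (h1 : -(n : ℤ) ≤ m) (h2 : m ≤ n) :
    betaCoeff κ R J n m = alphaCoeff κ R J n m + gammaCoeff κ R J n m := by
  have hw := contDiff_wave hκ h1 h2
  have hi1 : IntegrableOn (fun y => wave κ n m y • J y) (ball 0 R) := by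
    have := integrable_apply (M := fun y => wave κ n m y • (1 : Matrix (Fin 3) (Fin 3) ℂ))
      (fun l s => by
        simp only [Matrix.smul_apply, smul_eq_mul]
        exact (hw.continuous.mul continuous_const).continuousOn) hJ
    simpa only [apply_smul_one] using this
  have hi2 := integrable_apply (M := fun y => hess (wave κ n m) y)
    (fun l s => (contDiff_hess hw l s).continuous.continuousOn) hJ
  have hi3 : IntegrableOn (fun y => ((κ : ℂ) ^ 2)⁻¹ • apply (hess (wave κ n m) y) (J y))
      (ball 0 R) := Integrable.smul (((κ : ℂ) ^ 2)⁻¹) hi2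
  simp only [betaCoeff, alphaCoeff, gammaCoeff]
  rw [← integral_smul, ← integral_add hi1 hi3]
  congr 1
  funext y
  rw [← apply_smul_one]
  simp [apply, dyad, Matrix.add_mulVec, Matrix.smul_mulVec]

lemma gammaCoeff_coord {κ R : ℝ} (hκ : 0 < κ) {J : R3 → C3} (hJ : IntegrableOn J (ball 0 R))
    {n : ℕ} {m : ℤ} (h1 : -(n : ℤ) ≤ m) (h2 : m ≤ n) (l : Fin 3) :
    gammaCoeff κ R J n m l = ((κ : ℂ) ^ 2)⁻¹ * ∫ y in ball (0 : R3) R,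
      ∑ s, J y s * partialDeriv s (partialDeriv l (wave κ n m)) y := by
  have hw := contDiff_wave hκ h1 h2
  have hc (l s : Fin 3) : ContinuousOn (fun y => hess (wave κ n m) y l s) (closedBall 0 R) :=
    (contDiff_hess hw l s).continuous.continuousOn
  rw [gammaCoeff, PiLp.smul_apply, smul_eq_mul, integral_apply_coord hc hJ,
    ← integral_finsetSum _ fun s _ =>
      integrableOn_mul_of_continuousOn (hc l s) (integrableOn_coord hJ s)]
  congr 2
  funext y
  refine Finset.sum_congr rfl fun s _ => ?_
  rw [mul_comm, partialDeriv_comm hw s l]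
  rfl

/-! ### Integration by parts -/

/-- A smooth cutoff function that is `1` on `B_r` and vanishes outside `B_{r'}`. -/
lemma exists_cutoff {r r' : ℝ} (hr : 0 < r) (hrr' : r < r') :
    ∃ χ : R3 → ℂ, IsTest χ ∧ (∀ y ∈ ball (0 : R3) r, χ =ᶠ[nhds y] fun _ => 1) ∧
      tsupport χ ⊆ closedBall 0 r' := by
  let f : ContDiffBump (0 : R3) := ⟨r, r', hr, hrr'⟩
  have hsupp : tsupport (fun y => ((f y : ℝ) : ℂ)) ⊆ closedBall 0 r' := by
    refine (closure_mono fun y hy => ?_).trans f.tsupport_eq.subset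
    simpa using hy
  refine ⟨fun y => ((f y : ℝ) : ℂ), ⟨Complex.ofRealCLM.contDiff.comp f.contDiff,
    HasCompactSupport.of_support_subset_isCompact (isCompact_closedBall 0 r')
      (subset_closure.trans hsupp)⟩, fun y hy => ?_, hsupp⟩
  filter_upwards [isOpen_ball.mem_nhds hy] with z hz
  rw [f.one_of_mem_closedBall (ball_subset_closedBall hz), Complex.ofReal_one]

lemma IsTest.mul {χ φ : R3 → ℂ} (hχ : IsTest χ) (hφ : ContDiff ℝ ∞ φ) :
    IsTest (fun y => χ y * φ y) :=
  ⟨hχ.1.mul hφ, hχ.2.mul_right⟩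

lemma eventuallyEq_partialDeriv {φ ψ : R3 → ℂ} {y : R3} (h : φ =ᶠ[nhds y] ψ) (i : Fin 3) :
    partialDeriv i φ =ᶠ[nhds y] partialDeriv i ψ := by
  filter_upwards [h.eventually_nhds] with x hx using partialDeriv_congr hx i

/-- The vanishing of the normal trace is tested on the derivatives of the wave, cut off outside the
ball. -/
lemma gammaCoeff_eq_zetaCoeff {κ R : ℝ} (hκ : 0 < κ) (hR : 0 < R) {J : R3 → C3}
    (hJ : J ∈ H0div R) {f : R3 → ℂ} (hf : IsL2Div R J f) {n : ℕ} {m : ℤ}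
    (h1 : -(n : ℤ) ≤ m) (h2 : m ≤ n) :
    gammaCoeff κ R J n m = zetaCoeff κ R f n m := by
  have hw := contDiff_wave hκ h1 h2
  have hJi := hJ.1.1.integrableOn
  have hfi := hf.1.integrableOn
  obtain ⟨χ, hχ, hχ1, -⟩ := exists_cutoff hR (lt_add_one R)
  have hgi (l : Fin 3) : IntegrableOn (fun y => f y * partialDeriv l (wave κ n m) y) (ball 0 R) := by
    simpa only [mul_comm] using integrableOn_mul_of_continuousOn
      (ContDiff.partialDeriv hw l).continuous.continuousOn hfi
  have hgrad (l : Fin 3) : (∫ y in ball (0 : R3) R, f y • grad (wave κ n m) y) l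
      = ∫ y in ball (0 : R3) R, f y * partialDeriv l (wave κ n m) y := by
    rw [eval_integral_piLp (fun l => ?_)]
    · rfl
    · exact hgi l
  ext l
  rw [gammaCoeff_coord hκ hJi h1 h2, zetaCoeff, PiLp.neg_apply, PiLp.smul_apply, smul_eq_mul, hgrad]
  have htr := hJ.2 f hf _ (hχ.mul (ContDiff.partialDeriv hw l))
  have hJw : IntegrableOn
      (fun y => ∑ s, J y s * partialDeriv s (partialDeriv l (wave κ n m)) y) (ball 0 R) := by
    refine integrable_finsetSum _ fun s _ => ?_
    exact (integrableOn_mul_of_continuousOn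
      (ContDiff.partialDeriv (ContDiff.partialDeriv hw l) s).continuous.continuousOn
      (integrableOn_coord hJi s)).congr (Filter.Eventually.of_forall fun y => mul_comm _ _)
  have hcut : normalTrace R J f (fun y => χ y * partialDeriv l (wave κ n m) y)
      = ∫ y in ball (0 : R3) R, ((∑ s, J y s * partialDeriv s (partialDeriv l (wave κ n m)) y)
        + f y * partialDeriv l (wave κ n m) y) := by
    refine setIntegral_congr_fun measurableSet_ball fun y hy => ?_
    have hloc : (fun y => χ y * partialDeriv l (wave κ n m) y) =ᶠ[nhds y]
        partialDeriv l (wave κ n m) := by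
      filter_upwards [hχ1 y hy] with z hz
      rw [hz, one_mul]
    have h0 : χ y * partialDeriv l (wave κ n m) y = partialDeriv l (wave κ n m) y :=
      hloc.eq_of_nhds
    simp only [partialDeriv_congr hloc, h0]
  rw [hcut, integral_add hJw (hgi l)] at htr
  linear_combination ((κ : ℂ) ^ 2)⁻¹ * htr

/-- The distribution `∇(∇·J)` vanishes off the support of `J`. -/
lemma ae_eq_zero_gradDiv {R : ℝ} {J F : R3 → C3} (hF : IsL2GradDiv R J F) {K : Set R3}
    (hK : IsCompact K) (hJK : ∀ᵐ y ∂(volume.restrict (ball (0 : R3) R)), y ∉ K → J y = 0)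
    (i : Fin 3) : ∀ᵐ y ∂(volume.restrict (ball (0 : R3) R)), y ∉ K → F y i = 0 := by
  have hU : IsOpen (ball (0 : R3) R \ K) := isOpen_ball.sdiff hK.isClosed
  have hFi := integrableOn_coord hF.1.integrableOn i
  have key : ∀ᵐ y ∂(volume : Measure R3), y ∈ ball (0 : R3) R \ K → F y i = 0 := by
    refine hU.ae_eq_zero_of_integral_contDiff_smul_eq_zero
      (hFi.mono_set Set.sdiff_subset).locallyIntegrableOn fun g hg hgc hgs => ?_
    have hsupp : tsupport (fun y => (g y : ℂ)) ⊆ tsupport g :=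
      closure_mono fun y hy => by simpa using hy
    have htest : IsTest (fun y => (g y : ℂ)) :=
      ⟨Complex.ofRealCLM.contDiff.comp hg, hgc.mono' (subset_closure.trans hsupp)⟩
    have hint := hF.2 _ htest (hsupp.trans (hgs.trans Set.sdiff_subset)) i
    have hleft : ∫ y in ball (0 : R3) R,
        ∑ j, J y j * partialDeriv j (partialDeriv i fun y => (g y : ℂ)) y = 0 := by
      rw [← integral_zero R3 ℂ (μ := volume.restrict (ball (0 : R3) R))]
      refine integral_congr_ae ?_
      filter_upwards [hJK] with y hy
      by_cases hyK : y ∈ K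
      · have hloc : (fun y => (g y : ℂ)) =ᶠ[nhds y] fun _ => 0 := by
          have hyg : y ∉ tsupport (fun y => (g y : ℂ)) := fun h => (hgs (hsupp h)).2 hyK
          exact notMem_tsupport_iff_eventuallyEq.1 hyg
        have h0 (j : Fin 3) : partialDeriv j (partialDeriv i fun y => (g y : ℂ)) y = 0 := by
          have hi : partialDeriv i (fun y => (g y : ℂ)) =ᶠ[nhds y] fun _ => 0 := by
            refine (eventuallyEq_partialDeriv hloc i).trans ?_
            exact Filter.Eventually.of_forall fun z => partialDeriv_const i 0 z
          rw [partialDeriv_congr hi, partialDeriv_const]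
        simp [h0]
      · simp [hy hyK]
    rw [hleft] at hint
    rw [← setIntegral_eq_integral_of_forall_compl_eq_zero (s := ball (0 : R3) R), hint]
    · refine setIntegral_congr_fun measurableSet_ball fun y _ => ?_
      simp [mul_comm]
    · intro y hy
      have : g y = 0 := by
        by_contra hgy
        exact hy (hgs (subset_closure hgy)).1
      rw [this, zero_smul]
  rw [ae_restrict_iff' measurableSet_ball]
  filter_upwards [key] with y hy h1 h2 using hy ⟨h1, h2⟩

/-- The test function is the wave, cut off away from the support of `J` and inside the ball. -/
lemma gammaCoeff_eq_etaCoeff {κ R : ℝ} (hκ : 0 < κ) (hR : 0 < R) {J F : R3 → C3}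
    (hJ : InL2 R J) (hJc : CompactlySupportedInBall R J) (hF : IsL2GradDiv R J F) {n : ℕ} {m : ℤ}
    (h1 : -(n : ℤ) ≤ m) (h2 : m ≤ n) :
    gammaCoeff κ R J n m = etaCoeff κ R F n m := by
  have hw := contDiff_wave hκ h1 h2
  have hFi := hF.1.integrableOn
  obtain ⟨K, hK, hKR, hJK⟩ := hJc
  obtain ⟨r, ⟨hr, hrR⟩, hKr⟩ := exists_pos_lt_subset_ball hR hK.isClosed hKR
  obtain ⟨χ, hχ, hχ1, hχs⟩ := exists_cutoff hr (show r < (r + R) / 2 by linarith)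
  have htest := hχ.mul hw
  have hsupp : tsupport (fun y => χ y * wave κ n m y) ⊆ ball 0 R :=
    (tsupport_mul_subset_left.trans hχs).trans (closedBall_subset_ball (by linarith))
  ext l
  have hcoord : (∫ y in ball (0 : R3) R, wave κ n m y • F y) l
      = ∫ y in ball (0 : R3) R, wave κ n m y * F y l := by
    rw [eval_integral_piLp (fun l => ?_)]
    · rfl
    · exact integrableOn_mul_of_continuousOn hw.continuous.continuousOn (integrableOn_coord hFi l)
  rw [gammaCoeff_coord hκ hJ.integrableOn h1 h2, etaCoeff, PiLp.smul_apply, smul_eq_mul, hcoord]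
  congr 1
  have hloc {y : R3} (hy : y ∈ K) : (fun y => χ y * wave κ n m y) =ᶠ[nhds y] wave κ n m := by
    filter_upwards [hχ1 y (hKr hy)] with z hz
    rw [hz, one_mul]
  calc ∫ y in ball (0 : R3) R, ∑ s, J y s * partialDeriv s (partialDeriv l (wave κ n m)) y
      = ∫ y in ball (0 : R3) R,
          ∑ s, J y s * partialDeriv s (partialDeriv l fun y => χ y * wave κ n m y) y := by
        refine integral_congr_ae ?_
        filter_upwards [hJK] with y hy
        by_cases hyK : y ∈ K
        · simp only [partialDeriv_congr (eventuallyEq_partialDeriv (hloc hyK) l)]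
        · simp [hy hyK]
    _ = ∫ y in ball (0 : R3) R, F y l * (χ y * wave κ n m y) := hF.2 _ htest hsupp l
    _ = ∫ y in ball (0 : R3) R, wave κ n m y * F y l := by
        refine integral_congr_ae ?_
        filter_upwards [ae_eq_zero_gradDiv hF hK hJK l] with y hy
        by_cases hyK : y ∈ K
        · have : χ y * wave κ n m y = wave κ n m y := (hloc hyK).eq_of_nhds
          rw [this, mul_comm]
        · simp [hy hyK]

end Maxwell

theorem theorem3p1 (κ R : ℝ) (hκ : 0 < κ) (hR : 0 < R) :
    (∀ J : Maxwell.R3 → Maxwell.C3, Maxwell.InL2 R J →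
      (∀ (n : ℕ) (m : ℤ), -(n : ℤ) ≤ m → m ≤ n →
        Maxwell.betaCoeff κ R J n m =
          Maxwell.alphaCoeff κ R J n m + Maxwell.gammaCoeff κ R J n m) ∧
      (Maxwell.Nonradiating κ R J ↔ ∀ (n : ℕ) (m : ℤ), -(n : ℤ) ≤ m → m ≤ n →
        Maxwell.alphaCoeff κ R J n m + Maxwell.gammaCoeff κ R J n m = 0)) ∧
    (∀ J ∈ Maxwell.H0div R, ∀ divJ : Maxwell.R3 → ℂ, Maxwell.IsL2Div R J divJ →
      (∀ (n : ℕ) (m : ℤ), -(n : ℤ) ≤ m → m ≤ n →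
        Maxwell.betaCoeff κ R J n m =
          Maxwell.alphaCoeff κ R J n m + Maxwell.zetaCoeff κ R divJ n m) ∧
      (Maxwell.Nonradiating κ R J ↔ ∀ (n : ℕ) (m : ℤ), -(n : ℤ) ≤ m → m ≤ n →
        Maxwell.alphaCoeff κ R J n m + Maxwell.zetaCoeff κ R divJ n m = 0)) ∧
    (∀ J ∈ Maxwell.HdivGrad R, Maxwell.CompactlySupportedInBall R J →
      ∀ gradDivJ : Maxwell.R3 → Maxwell.C3, Maxwell.IsL2GradDiv R J gradDivJ →
      (Maxwell.Nonradiating κ R J ↔ ∀ (n : ℕ) (m : ℤ), -(n : ℤ) ≤ m → m ≤ n →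
        Maxwell.alphaCoeff κ R J n m + Maxwell.etaCoeff κ R gradDivJ n m = 0)) := by
  have hi {J : Maxwell.R3 → Maxwell.C3} (hJ : Maxwell.InL2 R J) :
      (∀ (n : ℕ) (m : ℤ), -(n : ℤ) ≤ m → m ≤ n → Maxwell.betaCoeff κ R J n m
        = Maxwell.alphaCoeff κ R J n m + Maxwell.gammaCoeff κ R J n m) ∧
      (Maxwell.Nonradiating κ R J ↔ ∀ (n : ℕ) (m : ℤ), -(n : ℤ) ≤ m → m ≤ n →
        Maxwell.alphaCoeff κ R J n m + Maxwell.gammaCoeff κ R J n m = 0) := by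
    have hβ := fun n m h1 h2 => Maxwell.betaCoeff_eq_alphaCoeff_add_gammaCoeff (n := n) (m := m)
      hκ hJ.integrableOn h1 h2
    refine ⟨hβ, (Maxwell.nonradiating_iff_betaCoeff hκ hR hJ.integrableOn).trans ?_⟩
    refine forall₄_congr fun n m h1 h2 => ?_
    rw [hβ n m h1 h2]
  refine ⟨fun J hJ => hi hJ, fun J hJ f hf => ?_, fun J hJ hJc F hF => ?_⟩
  · obtain ⟨hβ, hN⟩ := hi hJ.1.1
    refine ⟨fun n m h1 h2 => ?_, hN.trans (forall₄_congr fun n m h1 h2 => ?_)⟩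
    · rw [hβ n m h1 h2, Maxwell.gammaCoeff_eq_zetaCoeff hκ hR hJ hf h1 h2]
    · rw [Maxwell.gammaCoeff_eq_zetaCoeff hκ hR hJ hf h1 h2]
  · refine (hi hJ.1).2.trans (forall₄_congr fun n m h1 h2 => ?_)
    rw [Maxwell.gammaCoeff_eq_etaCoeff hκ hR hJ.1 hJc hF h1 h2]
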